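/- **Theorem (Compressive sensing via integer matrices).** For integers $M\ge 2$, $n\ge 2$ put $L=\lceil \log n/\log M\rceil$. *Ensemble.* Given $R,\mu$, let every $j\in\{1,\dots,n\}$ (left vertices) pick, independently, three distinct right vertices from $\{1,\dots,\mu\}$ uniformly at random. Independently, assign to the $3n$ edges of this bipartite graph $3n$ distinct vectors chosen uniformly at random from $\mathcal C=\{c\in\{1,\dots,M\}^R:\gcd(c_1,\dots,c_R)=1\}$; write $a_{ij}$ for the vector of the edge $(i,j)$ and $a_{ij}=0\in\mathbb Z^R$ if there is no such edge. The $R\mu\times n$ matrix $A$ consists of $\mu$ groups of $R$ rows, the block of column $j$ in group $i$ being $a_{ij}$. *Decoder (SHO-FA-INT).* On input $(A,y)$, $y=(y_1,\dots,y_\mu)\in(\mathbb R^R)^\mu$, start with residual $\tilde y=y$, $\hat d=0$, and $\mathcal D=\{i:\tilde y_i\neq 0\}$. As long as $\mathcal D\neq\emptyset$, pick $i\in\mathcal D$ uniformly at random. If $\tilde y_i=x\,a_{ij}$ for some edge $(i,j)$ and some $x\neq0$, add $x$ to $\hat d_j$, subtract $x\,a_{i'j}$ from $\tilde y_{i'}$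 for each of the three neighbours $i'$ of $j$, and update $\mathcal D=\{i:\tilde y_i\ne0\}$; otherwise change nothing. Output $\hat d$ when $\mathcal D=\emptyset$. The test looks up $\tilde y_i$, scaled to entries with sum $1$, in a dictionary of the scaled vectors $a_{ij}$ of the edges at $i$, which is prepared from $A$. The operations counted are real additions, subtractions, multiplications, divisions and zero tests (including the zero tests that set up $\mathcal D$), one operation for each random pick, and $R$ operations for each dictionary lookup; preparing tables from $A$ (neighbourhoods, dictionaries, entry sums of the $a_{ij}$) is not counted. *Claim.* There are absolute constants $c,K>0$ such that for all integers $M\ge2$, $n\ge 2$, $1\le k\le n$, all real $a$, and all $R,\mu\in\mathbb N$ with $$cL\le R\le aL,\qquad ck\le\mu\le ak$$ (so that $A$ has $m=R\mu\le a^2kL$ rows), the following hold. 0. $M^R/\zeta(R)\ge 3n$, $|\mathcal C|\ge 3n$ and $\mu\ge3$; in particular the ensemble exists. 1. For every fixed $d\in\mathbb R^n$ with at most $k$ nonzero entries, with probability at least $1-K/k$ over $A$, both of the following hold on the input $(A,Ad)$: with probability $1$ over the decoder's random picks, the decoder terminates with output $\hat d=d$; and 2. with probability at least $1-K/k$ over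 the decoder's random picks, it does so after at most $K a^2\,kL$ operations. 3. For every row of $A$, the expected number of nonzero entries is at most $K\,n/k$. -/

import Mathlib

noncomputable section

namespace ShoFaInt

/-! ### The random measurement matrix -/

/-- The vectors `(c₁, …, c_R)` with entries in `{1, …, M}` and `gcd (c₁, …, c_R) = 1`. -/
def coprimeVectors (M R : ℕ) : Finset (Fin R → ℕ) :=
  (Fintype.piFinset fun _ : Fin R => Finset.Icc 1 M).filter fun c => Finset.univ.gcd c = 1

/-- The (finite) sample space of the ensemble.  The first component is the bipartite graph: every
left vertex `j` picks three distinct right vertices.  The second component gives the `3 n` edges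
(the `l`-th edge at the left vertex `j` is `(j, l)`) pairwise distinct coprime vectors. -/
abbrev Design (M n R μ : ℕ) : Type :=
  (Fin n → Fin 3 ↪ Fin μ) × (Fin n × Fin 3 ↪ coprimeVectors M R)

/-- The measurement matrix.  It has `R μ` rows; the row `(i, r)` is the `r`-th row of the `i`-th
group of `R` rows.  The block of column `j` in group `i` is the weight vector of the edge `(i, j)`
if there is such an edge, and zero otherwise. -/
def Design.matrix {M n R μ : ℕ} (ω : Design M n R μ) : Matrix (Fin μ × Fin R) (Fin n) ℕ :=
  Matrix.of fun p j => ∑ l : Fin 3, if ω.1 j l = p.1 then (ω.2 (j, l)).1 p.2 else 0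

/-- Expectation over the uniform distribution on the sample space, that is: all left vertices choose
their triples uniformly and independently, and, independently of the graph, the weights are a
uniformly random choice of `3 n` distinct coprime vectors. -/
def ensembleMean {M n R μ : ℕ} (f : Design M n R μ → ℝ) : ℝ :=
  (∑ ω, f ω) / Fintype.card (Design M n R μ)

open Classical in
/-- Probability over the ensemble. -/
def ensembleProb {M n R μ : ℕ} (p : Design M n R μ → Prop) : ℝ :=
  ensembleMean fun ω => if p ω then 1 else 0

/-- The measurement output `A d`. -/
def measure {μ R n : ℕ} (A : Matrix (Fin μ × Fin R) (Fin n) ℕ) (d : Fin n → ℝ) :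
    Fin μ × Fin R → ℝ :=
  (A.map fun a => (a : ℝ)).mulVec d

/-! ### Computations that count their operations -/

/-- A value together with the number of elementary operations spent on computing it. -/
structure Timed (α : Type) where
  val : α
  ops : ℕ

instance : Monad Timed where
  pure a := ⟨a, 0⟩
  bind x f := ⟨(f x.val).val, x.ops + (f x.val).ops⟩

namespace Timed

/-- One elementary operation without a result. -/
def tick : Timed Unit := ⟨(), 1⟩

def add (x y : ℝ) : Timed ℝ := ⟨x + y, 1⟩

def sub (x y : ℝ) : Timed ℝ := ⟨x - y, 1⟩

def mul (x y : ℝ) : Timed ℝ := ⟨x * y, 1⟩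

def div (x y : ℝ) : Timed ℝ := ⟨x / y, 1⟩

/-- Test whether a real number is zero. -/
def isZero (x : ℝ) : Timed Bool := ⟨decide (x = 0), 1⟩

/-- Replace the entry `a i` by the result of `f i`, for every `i ∈ T`; the entries outside `T` are
not touched.  The cost is the total cost of the `f i` with `i ∈ T`. -/
def updateOn {ι β : Type} [DecidableEq ι] (T : Finset ι) (a : ι → β) (f : ι → Timed β) :
    Timed (ι → β) :=
  ⟨fun i => if i ∈ T then (f i).val else a i, ∑ i ∈ T, (f i).ops⟩

/-- Compute a vector entry by entry. -/
def vec {R : ℕ} {β : Type} (f : Fin R → Timed β) : Timed (Fin R → β) :=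
  ⟨fun r => (f r).val, ∑ r, (f r).ops⟩

/-- Add up the entries of a vector, with `R` additions. -/
def sum {R : ℕ} (v : Fin R → ℝ) : Timed ℝ := ⟨∑ r, v r, R⟩

/-- Test whether a vector is not zero, with one zero test per entry. -/
def isNonzeroVec {R : ℕ} (v : Fin R → ℝ) : Timed Bool := do
  let z ← vec fun r => isZero (v r)
  return !decide (∀ r, z r = true)

end Timed

/-! ### The decoder -/

section Decoder

variable {μ R n : ℕ}

/-- The right neighbours of the left vertex `j`, as read off from the matrix. -/
def nbrs (A : Matrix (Fin μ × Fin R) (Fin n) ℕ) (j : Fin n) : Finset (Fin μ) :=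
  Finset.univ.filter fun i => ∃ r, A (i, r) j ≠ 0

/-- The sum of the entries of the weight vector of the edge `(i, j)`. -/
def weightSum (A : Matrix (Fin μ × Fin R) (Fin n) ℕ) (i : Fin μ) (j : Fin n) : ℝ :=
  ∑ r, (A (i, r) j : ℝ)

/-- The signature of the edge `(i, j)`: its weight vector scaled to have entries with sum `1`. -/
def signature (A : Matrix (Fin μ × Fin R) (Fin n) ℕ) (i : Fin μ) (j : Fin n) : Fin R → ℝ :=
  fun r => (A (i, r) j : ℝ) / weightSum A i j

open Classical in
/-- The dictionary of the right vertex `i`, prepared from the matrix alone: a left neighbour of `i`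
whose signature is the given key, if there is one.  Reading a dictionary at a key of length `R`
is charged `R` operations. -/
def lookup (A : Matrix (Fin μ × Fin R) (Fin n) ℕ) (i : Fin μ) (key : Fin R → ℝ) :
    Timed (Option (Fin n)) :=
  ⟨if h : ∃ j, i ∈ nbrs A j ∧ signature A i j = key then some h.choose else none, R⟩

/-- The data kept by the decoder: the residual measurement vector (in groups), the reconstruction
vector, and the flags that mark the right vertices of the neighbourly set. -/
structure State (μ R n : ℕ) where
  residual : Fin μ → Fin R → ℝ
  estimate : Fin n → ℝ
  flag : Fin μ → Bool

/-- The neighbourly set: the flagged right vertices. -/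
def State.neighbourly (s : State μ R n) : Finset (Fin μ) :=
  Finset.univ.filter fun i => s.flag i = true

/-- The first state: the residual is `y`, the reconstruction vector is zero, and the neighbourly set
consists of the right vertices whose group of measurements is not zero. -/
def start (n : ℕ) (y : Fin μ × Fin R → ℝ) : Timed (State μ R n) := do
  let flag ← Timed.updateOn Finset.univ (fun _ => false)
    fun i => Timed.isNonzeroVec fun r => y (i, r)
  return ⟨fun i r => y (i, r), 0, flag⟩

/-- One iteration at the right vertex `i`.  If the residual at `i` is a nonzero multiple `x` of the
weight vector of an edge `(i, j)`, then `i` is declared a leaf with parent `j`: the value `x` is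
added to the `j`-th entry of the reconstruction vector, its contribution is cancelled from the
residual at the neighbours of `j`, and these enter or leave the neighbourly set according to
whether their residual is zero.  Otherwise nothing changes. -/
def visit (A : Matrix (Fin μ × Fin R) (Fin n) ℕ) (s : State μ R n) (i : Fin μ) :
    Timed (State μ R n) := do
  let total ← Timed.sum (s.residual i)
  let z ← Timed.isZero total
  if z then
    return s
  else
    let key ← Timed.vec fun r => Timed.div (s.residual i r) total
    match ← lookup A i key with
    | none => return s
    | some j =>
      let x ← Timed.div total (weightSum A i j)
      let e ← Timed.add (s.estimate j) x
      let residual ← Timed.updateOn (nbrs A j) s.residual fun i' =>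
        Timed.vec fun r => do
          let p ← Timed.mul x (A (i', r) j)
          Timed.sub (s.residual i' r) p
      let flag ← Timed.updateOn (nbrs A j) s.flag fun i' => Timed.isNonzeroVec (residual i')
      return ⟨residual, Function.update s.estimate j e, flag⟩

/-- One iteration of the decoder: a uniformly random right vertex of the neighbourly set is picked
(one operation) and visited.  When the neighbourly set is empty, the decoder has terminated, and
nothing changes any more. -/
def step (A : Matrix (Fin μ × Fin R) (Fin n) ℕ) (c : Timed (State μ R n)) :
    PMF (Timed (State μ R n)) :=
  if h : c.val.neighbourly.Nonempty then
    (PMF.uniformOfFinset c.val.neighbourly h).map fun i => do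
      let s ← c
      Timed.tick
      visit A s i
  else PMF.pure c

/-- The distribution of the state of the decoder, and of the number of operations that it has spent,
after at most `T` iterations on the input `(A, y)`. -/
def decode (A : Matrix (Fin μ × Fin R) (Fin n) ℕ) (y : Fin μ × Fin R → ℝ) :
    ℕ → PMF (Timed (State μ R n))
  | 0 => PMF.pure (start n y)
  | T + 1 => (decode A y T).bind (step A)

/-- The probability, over the random choices of the decoder on the input `(A, y)`, that it terminates,
with an output vector and a total number of operations that satisfy `Q`. -/
def outcomeProb (A : Matrix (Fin μ × Fin R) (Fin n) ℕ) (y : Fin μ × Fin R → ℝ)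
    (Q : (Fin n → ℝ) → ℕ → Prop) : ENNReal :=
  ⨆ T, (decode A y T).toOuterMeasure
    {c | c.val.neighbourly = ∅ ∧ Q c.val.estimate c.ops}

end Decoder

end ShoFaInt

end

/-! The proof separates a deterministic condition on the matrix, `Decodable`, from the randomness of
the decoder and of the ensemble.

Let `U` be the set of columns of the support not yet recovered, and call a right vertex a leaf if
exactly one column of `U` meets it. `Decodable` asks that every subset of the support expands by a
factor of two, and that a group met by `U` has a residual parallel to the weight vector of an edge
only if it is a leaf and that edge leads to its parent. So visits never err (`Pending.visit`), and
the invariant `Pending` persists. Three edges per column and expansion make at least a third of the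
neighbourly set leaves (`Pending.card_neighbourly_le`). A random pick thus halves the potential `2 ^
|U|` with probability at least `1/3`, so its mean falls by a factor `5/6` per step, and the failure
probability after `T` steps is at most `(5/6) ^ T * 2 ^ k` (`run_failure_le`). Letting `T` tend to
infinity gives correctness almost surely; `T = 8 * k` gives the running time.

The ensemble violates `Decodable` with probability at most `3 / k`. A union bound over small sets
and their possible neighbourhoods handles expansion (`freq_not_expanding_le`). For false matches,
all weights but one are fixed: a match then leaves at most `M` choices for the last weight
(`freq_confused_le`), against at least `M ^ R / 2` coprime vectors. -/

noncomputable section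

namespace ShoFaInt

open Finset

/-! ### The decoder as a Markov chain, and the cost of its operations -/

section Decoding

variable {μ R n : ℕ}

/-- The distribution after at most `T` further iterations from the state `c`. -/
def run (A : Matrix (Fin μ × Fin R) (Fin n) ℕ) :
    ℕ → Timed (State μ R n) → PMF (Timed (State μ R n))
  | 0, c => PMF.pure c
  | T + 1, c => (step A c).bind (run A T)

/-- `decode` appends iterations at the end, whereas the failure bound conditions on the first
iteration; this reconciles the two recursions. -/
theorem run_succ' (A : Matrix (Fin μ × Fin R) (Fin n) ℕ) (T : ℕ) (c : Timed (State μ R n)) :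
    run A (T + 1) c = (run A T c).bind (step A) := by
  induction T generalizing c with
  | zero => simp [run]
  | succ T ih =>
    rw [run]
    conv_rhs => rw [run]
    rw [PMF.bind_bind]
    congr 1
    funext c'
    exact ih c'

theorem decode_eq_run (A : Matrix (Fin μ × Fin R) (Fin n) ℕ) (y : Fin μ × Fin R → ℝ) (T : ℕ) :
    decode A y T = run A T (start n y) := by
  induction T with
  | zero => rfl
  | succ T ih => rw [decode, ih, run_succ']

/-- The support of a signal. -/
def signalSupport (d : Fin n → ℝ) : Finset (Fin n) := univ.filter fun j => d j ≠ 0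

/-- The properties of a matrix that let the decoder recover the signal `d`. -/
structure Decodable (A : Matrix (Fin μ × Fin R) (Fin n) ℕ) (d : Fin n → ℝ) : Prop where
  entry_pos : ∀ i j r, i ∈ nbrs A j → 0 < A (i, r) j
  card_nbrs : ∀ j, (nbrs A j).card ≤ 3
  expand : ∀ E ⊆ signalSupport d, 2 * E.card ≤ (E.biUnion (nbrs A)).card
  distinguish : ∀ i, ∀ U ⊆ signalSupport d, ∀ j', i ∈ nbrs A j' → ∀ x : ℝ,
    (∃ j ∈ U, i ∈ nbrs A j) → (∀ r, ∑ j ∈ U, d j * A (i, r) j = x * A (i, r) j') →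
    (U.filter fun j => i ∈ nbrs A j) = {j'}

/-- The state `s` of the decoder has recovered exactly the entries of `d` outside `U`. -/
structure Pending (A : Matrix (Fin μ × Fin R) (Fin n) ℕ) (d : Fin n → ℝ) (U : Finset (Fin n))
    (s : State μ R n) : Prop where
  subset : U ⊆ signalSupport d
  residual : ∀ i r, s.residual i r = ∑ j ∈ U, d j * A (i, r) j
  estimate : ∀ j, s.estimate j = if j ∈ U then 0 else d j
  flag : ∀ i, s.flag i = true ↔ ∃ r, s.residual i r ≠ 0

theorem entry_eq_zero {A : Matrix (Fin μ × Fin R) (Fin n) ℕ} {i : Fin μ} {j : Fin n}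
    (h : i ∉ nbrs A j) (r : Fin R) : A (i, r) j = 0 := by
  by_contra h'
  exact h (by simpa [nbrs] using ⟨r, h'⟩)

theorem isNonzeroVec_val (v : Fin R → ℝ) : (Timed.isNonzeroVec v).val = true ↔ ∃ r, v r ≠ 0 := by
  simp [Timed.isNonzeroVec, Timed.vec, Timed.isZero, bind, pure]

theorem isNonzeroVec_ops (v : Fin R → ℝ) : (Timed.isNonzeroVec v).ops = R := by
  simp [Timed.isNonzeroVec, Timed.vec, Timed.isZero, bind, pure]

theorem start_pending (A : Matrix (Fin μ × Fin R) (Fin n) ℕ) (d : Fin n → ℝ) :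
    Pending A d (signalSupport d) (start n (measure A d)).val where
  subset := Subset.rfl
  residual i r := by
    simp only [start, bind, pure, measure, Matrix.mulVec, dotProduct, Matrix.map_apply,
      signalSupport, sum_filter]
    refine sum_congr rfl fun j _ => ?_
    by_cases h : d j = 0 <;> simp [h, mul_comm]
  estimate j := by
    simp only [start, bind, pure, signalSupport, mem_filter, mem_univ, true_and]
    by_cases h : d j = 0 <;> simp [h]
  flag i := by
    simp [start, bind, pure, Timed.updateOn, isNonzeroVec_val]

theorem start_ops (y : Fin μ × Fin R → ℝ) : (start n y).ops = μ * R := by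
  simp [start, bind, pure, Timed.updateOn, isNonzeroVec_ops]

theorem lookup_ops (A : Matrix (Fin μ × Fin R) (Fin n) ℕ) (i : Fin μ) (key : Fin R → ℝ) :
    (lookup A i key).ops = R := rfl

theorem lookup_eq_none {A : Matrix (Fin μ × Fin R) (Fin n) ℕ} {i : Fin μ} {key : Fin R → ℝ}
    (h : (lookup A i key).val = none) : ∀ j, i ∈ nbrs A j → signature A i j ≠ key := by
  intro j hj hk
  have : ∃ j, i ∈ nbrs A j ∧ signature A i j = key := ⟨j, hj, hk⟩
  simp [lookup, this] at h

theorem lookup_eq_some {A : Matrix (Fin μ × Fin R) (Fin n) ℕ} {i : Fin μ} {key : Fin R → ℝ}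
    {j : Fin n} (h : (lookup A i key).val = some j) : i ∈ nbrs A j ∧ signature A i j = key := by
  by_cases hex : ∃ j, i ∈ nbrs A j ∧ signature A i j = key
  · simp only [lookup, hex, dif_pos, Option.some.injEq] at h
    rw [← h]
    exact hex.choose_spec
  · simp [lookup, hex] at h

/-- The state after the parent `j` of the leaf `i` has been found. -/
def resolve (A : Matrix (Fin μ × Fin R) (Fin n) ℕ) (s : State μ R n) (j : Fin n) (x : ℝ) :
    State μ R n where
  residual i' := if i' ∈ nbrs A j then fun r => s.residual i' r - x * A (i', r) j
    else s.residual i'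
  estimate := Function.update s.estimate j (s.estimate j + x)
  flag i' := if i' ∈ nbrs A j then
      (Timed.isNonzeroVec fun r => s.residual i' r - x * A (i', r) j).val
    else s.flag i'

theorem visit_cases (A : Matrix (Fin μ × Fin R) (Fin n) ℕ) (s : State μ R n) (i : Fin μ) :
    (∑ r, s.residual i r = 0 ∧ (visit A s i).val = s ∧ (visit A s i).ops = R + 1) ∨
    (∑ r, s.residual i r ≠ 0 ∧
      (lookup A i fun r => s.residual i r / ∑ r, s.residual i r).val = none ∧
      (visit A s i).val = s ∧ (visit A s i).ops = 3 * R + 1) ∨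
    ∃ j, ∑ r, s.residual i r ≠ 0 ∧
      (lookup A i fun r => s.residual i r / ∑ r, s.residual i r).val = some j ∧
      (visit A s i).val = resolve A s j ((∑ r, s.residual i r) / weightSum A i j) ∧
      (visit A s i).ops = 3 * R + 3 + (nbrs A j).card * (3 * R) := by
  by_cases h0 : ∑ r, s.residual i r = 0
  · left
    simp [visit, bind, pure, Timed.sum, Timed.isZero, h0]
  right
  rcases hl : (lookup A i fun r => s.residual i r / ∑ r, s.residual i r).val with _ | j
  · left
    simp [visit, bind, pure, Timed.sum, Timed.isZero, h0, Timed.vec, Timed.div, hl, lookup_ops]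
    ring
  · right
    refine ⟨j, h0, rfl, ?_, ?_⟩
    · simp only [visit, bind, pure, Timed.sum, Timed.isZero, h0, Timed.vec, Timed.div, hl,
        decide_false, Bool.false_eq_true, if_false, resolve, Timed.add, Timed.updateOn,
        Timed.mul, Timed.sub]
      congr 1
      funext i'
      split_ifs <;> rfl
    · simp [visit, bind, pure, Timed.sum, Timed.isZero, h0, Timed.vec, Timed.div, hl, lookup_ops,
        Timed.add, Timed.updateOn, Timed.mul, Timed.sub, isNonzeroVec_ops]
      ring

end Decoding

/-! ### Progress of the decoder on a decodable matrix -/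

section Progress

variable {μ R n : ℕ} {A : Matrix (Fin μ × Fin R) (Fin n) ℕ} {d : Fin n → ℝ} {U : Finset (Fin n)}
  {s : State μ R n} {i : Fin μ}

theorem Pending.mem_neighbourly (h : Pending A d U s) :
    i ∈ s.neighbourly ↔ ∃ r, s.residual i r ≠ 0 := by
  simp [State.neighbourly, h.flag]

theorem Pending.ne_zero (h : Pending A d U s) {j : Fin n} (hj : j ∈ U) : d j ≠ 0 := by
  simpa [signalSupport] using h.subset hj

theorem Pending.exists_edge (h : Pending A d U s) (hi : i ∈ s.neighbourly) :
    ∃ j ∈ U, i ∈ nbrs A j := by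
  obtain ⟨r, hr⟩ := h.mem_neighbourly.1 hi
  rw [h.residual] at hr
  obtain ⟨j, hj, hne⟩ := exists_ne_zero_of_sum_ne_zero hr
  refine ⟨j, hj, ?_⟩
  by_contra hn
  simp [entry_eq_zero hn] at hne

theorem Pending.residual_leaf (h : Pending A d U s) {j : Fin n}
    (hj : (U.filter fun j => i ∈ nbrs A j) = {j}) (r : Fin R) :
    s.residual i r = d j * A (i, r) j := by
  have : ∑ j ∈ U.filter (fun j => i ∈ nbrs A j), d j * (A (i, r) j : ℝ) =
      ∑ j ∈ U, d j * (A (i, r) j : ℝ) := by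
    rw [sum_filter]
    refine sum_congr rfl fun j _ => ?_
    split_ifs with hn
    · rfl
    · simp [entry_eq_zero hn]
  rw [h.residual, ← this, hj, sum_singleton]

theorem Pending.sum_residual_leaf (h : Pending A d U s) {j : Fin n}
    (hj : (U.filter fun j => i ∈ nbrs A j) = {j}) :
    ∑ r, s.residual i r = d j * weightSum A i j := by
  simp_rw [h.residual_leaf hj, weightSum, mul_sum]

theorem Decodable.weightSum_pos (hA : Decodable A d) (hR : 0 < R) {j : Fin n}
    (hj : i ∈ nbrs A j) : 0 < weightSum A i j := by
  have : Nonempty (Fin R) := ⟨⟨0, hR⟩⟩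
  exact sum_pos (fun r _ => by exact_mod_cast hA.entry_pos i j r hj) univ_nonempty

theorem Pending.resolve (h : Pending A d U s) {j : Fin n}
    (hj : j ∈ U) : Pending A d (U.erase j) (resolve A s j (d j)) := by
  have hres : ∀ i r, (ShoFaInt.resolve A s j (d j)).residual i r =
      ∑ j' ∈ U.erase j, d j' * A (i, r) j' := by
    intro i r
    have hsum := h.residual i r
    rw [← add_sum_erase U _ hj] at hsum
    simp only [ShoFaInt.resolve]
    split_ifs with hn
    · change s.residual i r - d j * (A (i, r) j : ℝ) = _
      rw [hsum]; ring
    · rw [hsum, entry_eq_zero hn]; simp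
  refine ⟨(erase_subset _ _).trans h.subset, hres, fun j' => ?_, fun i => ?_⟩
  · by_cases hjj : j' = j
    · subst hjj
      simp [ShoFaInt.resolve, h.estimate, hj]
    · simp [ShoFaInt.resolve, h.estimate, hjj]
  · by_cases hn : i ∈ nbrs A j
    · simp [ShoFaInt.resolve, hn, isNonzeroVec_val]
    · simp [ShoFaInt.resolve, hn, h.flag]

/-- A visit costs `O(R)` operations; it succeeds at the leaves and does no harm elsewhere. -/
theorem Pending.visit (hA : Decodable A d) (h : Pending A d U s) (hi : i ∈ s.neighbourly) :
    (visit A s i).ops + 1 ≤ 16 * R ∧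
    (((visit A s i).val = s ∧ (U.filter fun j => i ∈ nbrs A j).card ≠ 1) ∨
      ∃ j ∈ U, Pending A d (U.erase j) (visit A s i).val) := by
  have hR : 0 < R := by
    obtain ⟨r, -⟩ := h.mem_neighbourly.1 hi
    exact r.pos
  have hleaf : ∀ {j}, (U.filter fun j => i ∈ nbrs A j) = {j} → j ∈ U ∧ i ∈ nbrs A j := by
    intro j hj
    have : j ∈ U.filter fun j => i ∈ nbrs A j := by rw [hj]; exact mem_singleton_self j
    simpa using this
  rcases visit_cases A s i with ⟨h0, hv, ho⟩ | ⟨h0, hl, hv, ho⟩ | ⟨j, h0, hl, hv, ho⟩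
  · refine ⟨by omega, Or.inl ⟨hv, fun hc => ?_⟩⟩
    obtain ⟨j, hj⟩ := card_eq_one.1 hc
    rw [h.sum_residual_leaf hj] at h0
    -- At a leaf the total is `d j` times a positive weight sum, so a zero total excludes leaves.
    exact mul_ne_zero (h.ne_zero (hleaf hj).1) (hA.weightSum_pos hR (hleaf hj).2).ne' h0
  · refine ⟨by omega, Or.inl ⟨hv, fun hc => ?_⟩⟩
    obtain ⟨j, hj⟩ := card_eq_one.1 hc
    refine lookup_eq_none hl j (hleaf hj).2 ?_
    funext r
    rw [h.sum_residual_leaf hj, h.residual_leaf hj, signature,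
      mul_div_mul_left _ _ (h.ne_zero (hleaf hj).1)]
  -- A match of signatures makes the residual a multiple of the weight vector of `(i, j)`. By
  -- `distinguish`, `i` is then a leaf with parent `j`, and the quotient of the sums is exactly `d
  -- j`.
  · obtain ⟨hij, hsig⟩ := lookup_eq_some hl
    have hw := (hA.weightSum_pos hR hij).ne'
    have hc := hA.distinguish i U h.subset j hij ((∑ r, s.residual i r) / weightSum A i j)
      (h.exists_edge hi) fun r => by
        have := congrFun hsig r
        simp only [signature] at this
        rw [← h.residual]
        field_simp at this ⊢
        linarith
    constructor
    · have := hA.card_nbrs j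
      have : (nbrs A j).card * (3 * R) ≤ 3 * (3 * R) := Nat.mul_le_mul_right _ this
      omega
    · refine Or.inr ⟨j, (hleaf hc).1, ?_⟩
      rw [hv, h.sum_residual_leaf hc, mul_div_cancel_right₀ _ hw]
      exact h.resolve (hleaf hc).1

/-- At least one third of the neighbourly set consists of leaves. -/
theorem Pending.card_neighbourly_le (hA : Decodable A d) (h : Pending A d U s) :
    s.neighbourly.card ≤
      3 * (s.neighbourly.filter fun i => (U.filter fun j => i ∈ nbrs A j).card = 1).card := by
  set V := U.biUnion (nbrs A) with hV
  have hsub : s.neighbourly ⊆ V := fun i hi => by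
    obtain ⟨j, hj, hij⟩ := h.exists_edge hi
    exact mem_biUnion.2 ⟨j, hj, hij⟩
  have hleaves : (V.filter fun i => (U.filter fun j => i ∈ nbrs A j).card = 1) ⊆
      s.neighbourly.filter fun i => (U.filter fun j => i ∈ nbrs A j).card = 1 := by
    intro i hi
    obtain ⟨hiV, hc⟩ := mem_filter.1 hi
    obtain ⟨j, hj⟩ := card_eq_one.1 hc
    have hjm : j ∈ U.filter fun j => i ∈ nbrs A j := by rw [hj]; exact mem_singleton_self j
    obtain ⟨hjU, hij⟩ := mem_filter.1 hjm
    refine mem_filter.2 ⟨h.mem_neighbourly.2 ?_, hc⟩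
    obtain ⟨r, -⟩ : ∃ r, A (i, r) j ≠ 0 := by simpa [nbrs] using hij
    refine ⟨r, ?_⟩
    rw [h.residual_leaf hj]
    exact mul_ne_zero (h.ne_zero hjU) (by exact_mod_cast (hA.entry_pos i j r hij).ne')
  have hcount : ∑ i ∈ V, (U.filter fun j => i ∈ nbrs A j).card ≤ 3 * U.card := by
    have h1 : ∑ i ∈ V, (U.filter fun j => i ∈ nbrs A j).card =
        ∑ j ∈ U, (V.filter fun i => i ∈ nbrs A j).card := by
      simp_rw [card_filter]
      exact sum_comm
    rw [h1, mul_comm, ← smul_eq_mul]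
    refine sum_le_card_nsmul _ _ _ fun j hj => (card_le_card ?_).trans (hA.card_nbrs j)
    intro i hi
    exact (mem_filter.1 hi).2
  -- Every vertex of `V` has degree at least two into `U`, unless it is a leaf, which is counted
  -- once more.
  have hdeg : 2 * V.card ≤ ∑ i ∈ V, (U.filter fun j => i ∈ nbrs A j).card +
      (V.filter fun i => (U.filter fun j => i ∈ nbrs A j).card = 1).card := by
    rw [card_filter, ← sum_add_distrib, mul_comm, ← smul_eq_mul]
    refine card_nsmul_le_sum _ _ _ fun i hi => ?_
    obtain ⟨j, hj, hij⟩ := mem_biUnion.1 hi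
    have : 0 < (U.filter fun j => i ∈ nbrs A j).card := card_pos.2 ⟨j, mem_filter.2 ⟨hj, hij⟩⟩
    split_ifs <;> omega
  have hVc : V.card ≤ 3 * U.card := by
    rw [mul_comm]
    exact card_biUnion_le_card_mul _ _ _ fun j _ => hA.card_nbrs j
  -- The number of leaves is at least `2|V| - 3|U|`, hence at least `|U|` by expansion, hence at
  -- least `|V| / 3`.
  have : 2 * U.card ≤ V.card := hA.expand U h.subset
  have := card_le_card hleaves
  have := card_le_card hsub
  omega

theorem Pending.nonempty (hR : 0 < R) (hA : Decodable A d) (h : Pending A d U s)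
    (hU : U.Nonempty) : s.neighbourly.Nonempty := by
  by_contra hn
  rw [not_nonempty_iff_eq_empty] at hn
  have hz : ∀ i r, ∑ j ∈ U, d j * (A (i, r) j : ℝ) = 0 := by
    intro i r
    rw [← h.residual]
    by_contra hr
    have := h.mem_neighbourly.2 ⟨r, hr⟩
    simp [hn] at this
  have hU1 := hA.expand U h.subset
  obtain ⟨i, hi⟩ : (U.biUnion (nbrs A)).Nonempty := card_pos.1 (by have := card_pos.2 hU; omega)
  obtain ⟨j, hj, hij⟩ := mem_biUnion.1 hi
  -- A vanishing residual is the multiple with `x = 0` of any edge at `i`, so `i` would be a leaf;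
  -- but the residual of a leaf does not vanish.
  have hc := hA.distinguish i U h.subset j hij 0 ⟨j, hj, hij⟩ fun r => by rw [hz, zero_mul]
  have := h.residual_leaf hc ⟨0, hR⟩
  rw [h.residual, hz] at this
  exact mul_ne_zero (h.ne_zero hj) (by exact_mod_cast (hA.entry_pos i j _ hij).ne') this.symm

theorem Pending.eq_empty (h : Pending A d ∅ s) : s.neighbourly = ∅ ∧ s.estimate = d := by
  refine ⟨eq_empty_of_forall_notMem fun i hi => ?_, funext fun j => by simp [h.estimate]⟩
  obtain ⟨j, hj, -⟩ := h.exists_edge hi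
  simp at hj

open scoped ENNReal

/-- The weight of an unrecovered set, which shrinks on average by a constant factor in each step. -/
def potential (U : Finset (Fin n)) : ℝ≥0∞ := if U = ∅ then 0 else 2 ^ U.card

/-- Removing the last column sends the potential from `2` to `0`; every other removal halves it
exactly. -/
theorem potential_erase_le {j : Fin n} (hj : j ∈ U) : potential (U.erase j) ≤ potential U / 2 := by
  have hU : U ≠ ∅ := ne_empty_of_mem hj
  rw [potential, potential, if_neg hU]
  split_ifs
  · exact zero_le
  · rw [← card_erase_add_one hj, pow_succ, ENNReal.mul_div_cancel_right] <;> simp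

/-- The worst case has the value `b / 2` on one third of `D` and `b` on the rest: `1/6 + 2/3 = 5/6`.
-/
theorem average_le {ι : Type*} [DecidableEq ι] (D : Finset ι) (p : ι → Prop) [DecidablePred p]
    (hD : D.Nonempty) (hp : D.card ≤ 3 * (D.filter p).card) (f : ι → ℝ≥0∞) (b : ℝ≥0∞)
    (hf : ∀ i ∈ D, f i ≤ b) (hpf : ∀ i ∈ D, p i → f i ≤ b / 2) :
    ∑ i ∈ D, (D.card : ℝ≥0∞)⁻¹ * f i ≤ 5 / 6 * b := by
  rw [← mul_sum]
  have h1 : ∑ i ∈ D, f i ≤ (5 / 6 * D.card) * b := by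
    calc ∑ i ∈ D, f i
        = ∑ i ∈ D.filter p, f i + ∑ i ∈ D.filter (fun i => ¬ p i), f i :=
          (sum_filter_add_sum_filter_not _ _ _).symm
      _ ≤ (D.filter p).card • (b / 2) + (D.filter fun i => ¬ p i).card • b :=
          add_le_add
            (sum_le_card_nsmul _ _ _ fun i hi => hpf i (mem_filter.1 hi).1 (mem_filter.1 hi).2)
            (sum_le_card_nsmul _ _ _ fun i hi => hf i (mem_filter.1 hi).1)
      _ = (((D.filter p).card : ℝ≥0∞) / 2 + (D.filter fun i => ¬ p i).card) * b := by
          simp only [nsmul_eq_mul, div_eq_mul_inv]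
          ring
      _ ≤ (5 / 6 * D.card) * b := by
          gcongr
          have hc := card_filter_add_card_filter_not (s := D) p
          generalize (D.filter p).card = x at *
          generalize (D.filter fun i => ¬ p i).card = y at *
          rw [← hc] at hp ⊢
          rw [← ENNReal.toReal_le_toReal (by finiteness) (by finiteness)]
          rw [ENNReal.toReal_add (by finiteness) (by finiteness)]
          simp only [ENNReal.toReal_div, ENNReal.toReal_mul, ENNReal.toReal_natCast,
            ENNReal.toReal_ofNat]
          push_cast
          have : (x : ℝ) + y ≤ 3 * x := by exact_mod_cast hp
          linarith
  have hD0 : (D.card : ℝ≥0∞) ≠ 0 := by simpa using hD.ne_empty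
  calc (D.card : ℝ≥0∞)⁻¹ * ∑ i ∈ D, f i
      ≤ (D.card : ℝ≥0∞)⁻¹ * ((5 / 6 * D.card) * b) := by gcongr
    _ = ((D.card : ℝ≥0∞)⁻¹ * D.card) * (5 / 6 * b) := by ring
    _ = 5 / 6 * b := by rw [ENNReal.inv_mul_cancel hD0 (by simp), one_mul]

/-- Induction on `T`, conditioning on the first pick. At `T = 0` the bound holds because the
potential is at least one while columns are missing; when none are, the decoder has stopped and
failure is impossible. The operation budget is relative to the cost already incurred, so that the
induction hypothesis applies after any visit. -/
theorem run_failure_le (hR : 0 < R) (hA : Decodable A d) (T : ℕ) :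
    ∀ (U : Finset (Fin n)) (c : Timed (State μ R n)), Pending A d U c.val →
      (run A T c).toOuterMeasure {c' | ¬ (c'.val.neighbourly = ∅ ∧ c'.val.estimate = d ∧
        c'.ops ≤ c.ops + 16 * R * T)} ≤ (5 / 6) ^ T * potential U := by
  induction T with
  | zero =>
    intro U c hc
    rw [run, PMF.toOuterMeasure_pure_apply]
    split_ifs with hb
    · have hU : U ≠ ∅ := by
        rintro rfl
        exact hb ⟨hc.eq_empty.1, hc.eq_empty.2, by omega⟩
      rw [potential, if_neg hU, pow_zero, one_mul]
      exact one_le_pow₀ (by norm_num)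
    · exact zero_le
  | succ T ih =>
    have hmono : ∀ (c c₁ : Timed (State μ R n)) (U : Finset (Fin n)), c₁.ops ≤ c.ops + 16 * R →
        Pending A d U c₁.val →
        (run A T c₁).toOuterMeasure {c' | ¬ (c'.val.neighbourly = ∅ ∧ c'.val.estimate = d ∧
          c'.ops ≤ c.ops + 16 * R * (T + 1))} ≤ (5 / 6) ^ T * potential U := by
      intro c c₁ U hops hc
      refine le_trans (MeasureTheory.measure_mono ?_) (ih U c₁ hc)
      intro c' hc' hn
      exact hc' ⟨hn.1, hn.2.1, hn.2.2.trans (by linarith)⟩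
    intro U c hc
    by_cases hU : U = ∅
    · subst hU
      rw [run, step, dif_neg (by rw [hc.eq_empty.1]; simp), PMF.pure_bind]
      refine (hmono c c ∅ (by omega) hc).trans ?_
      simp [potential]
    have hne := hc.nonempty hR hA (nonempty_iff_ne_empty.2 hU)
    rw [run, step, dif_pos hne, PMF.bind_map, PMF.toOuterMeasure_bind_apply, tsum_fintype]
    rw [← sum_subset (subset_univ c.val.neighbourly) fun i _ hi => by
      simp [PMF.uniformOfFinset_apply, hi]]
    rw [pow_succ', mul_assoc (5 / 6 : ℝ≥0∞)]
    refine le_trans (le_of_eq (sum_congr rfl fun i hi => ?_)) (average_le c.val.neighbourly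
      (fun i => (U.filter fun j => i ∈ nbrs A j).card = 1) hne (hc.card_neighbourly_le hA)
      (fun i => (run A T ⟨(visit A c.val i).val, c.ops + (1 + (visit A c.val i).ops)⟩).toOuterMeasure
        {c' | ¬ (c'.val.neighbourly = ∅ ∧ c'.val.estimate = d ∧
          c'.ops ≤ c.ops + 16 * R * (T + 1))}) _ (fun i hi => ?_) fun i hi hl => ?_)
    · rw [PMF.uniformOfFinset_apply_of_mem hne hi]
      rfl
    · obtain ⟨ho, ⟨hv, -⟩ | ⟨j, hj, hv⟩⟩ := hc.visit hA hi
      · exact hmono c ⟨(visit A c.val i).val, c.ops + (1 + (visit A c.val i).ops)⟩ U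
          (by dsimp only; omega) (by simpa only [hv] using hc)
      · refine (hmono c ⟨(visit A c.val i).val, c.ops + (1 + (visit A c.val i).ops)⟩ (U.erase j)
          (by dsimp only; omega) hv).trans ?_
        gcongr
        exact (potential_erase_le hj).trans ENNReal.half_le_self
    · obtain ⟨ho, ⟨-, hv⟩ | ⟨j, hj, hv⟩⟩ := hc.visit hA hi
      · exact absurd hl hv
      · refine (hmono c ⟨(visit A c.val i).val, c.ops + (1 + (visit A c.val i).ops)⟩ (U.erase j)
          (by dsimp only; omega) hv).trans ?_
        rw [mul_div_assoc]
        gcongr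
        exact potential_erase_le hj

theorem potential_le {k : ℕ} (hU : U.card ≤ k) : potential U ≤ 2 ^ k := by
  rw [potential]
  split_ifs
  · exact zero_le
  · exact pow_le_pow_right₀ (by norm_num) hU

theorem decode_success_ge (hR : 0 < R) (hA : Decodable A d) {k : ℕ}
    (hk : (signalSupport d).card ≤ k) (T : ℕ) :
    1 - (5 / 6) ^ T * 2 ^ k ≤ outcomeProb A (measure A d)
      fun dhat ops => dhat = d ∧ ops ≤ μ * R + 16 * R * T := by
  have h := run_failure_le hR hA T _ _ (start_pending A d)
  rw [← decode_eq_run, start_ops] at h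
  refine le_trans ?_ (le_iSup _ T)
  set p := decode A (measure A d) T
  set G := {c : Timed (State μ R n) | c.val.neighbourly = ∅ ∧ c.val.estimate = d ∧
    c.ops ≤ μ * R + 16 * R * T}
  have htot : 1 ≤ p.toOuterMeasure G + p.toOuterMeasure Gᶜ := by
    have h1 : p.toOuterMeasure Set.univ = 1 := by
      rw [PMF.toOuterMeasure_apply_eq_one_iff]
      exact Set.subset_univ _
    rw [← h1, ← Set.union_compl_self G]
    exact MeasureTheory.measure_union_le _ _
  rw [tsub_le_iff_right]
  refine htot.trans (add_le_add le_rfl (le_trans h ?_))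
  gcongr
  exact potential_le hk

theorem outcomeProb_le_one (y : Fin μ × Fin R → ℝ) (Q : (Fin n → ℝ) → ℕ → Prop) :
    outcomeProb A y Q ≤ 1 := by
  refine iSup_le fun T => ?_
  have h1 : (decode A y T).toOuterMeasure Set.univ = 1 := by
    rw [PMF.toOuterMeasure_apply_eq_one_iff]
    exact Set.subset_univ _
  rw [← h1]
  exact MeasureTheory.measure_mono (Set.subset_univ _)

theorem outcomeProb_mono {y : Fin μ × Fin R → ℝ} {Q Q' : (Fin n → ℝ) → ℕ → Prop}
    (h : ∀ v t, Q v t → Q' v t) : outcomeProb A y Q ≤ outcomeProb A y Q' :=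
  iSup_mono fun _ => MeasureTheory.measure_mono fun _ hc => ⟨hc.1, h _ _ hc.2⟩

theorem Decodable.outcomeProb_eq_one (hR : 0 < R) (hA : Decodable A d) :
    outcomeProb A (measure A d) (fun dhat _ => dhat = d) = 1 := by
  refine le_antisymm (outcomeProb_le_one _ _) ?_
  have hlim : Filter.Tendsto (fun T : ℕ => 1 - (5 / 6 : ℝ≥0∞) ^ T * 2 ^ (signalSupport d).card)
      Filter.atTop (nhds (1 - 0 * 2 ^ (signalSupport d).card)) := by
    refine ENNReal.Tendsto.sub tendsto_const_nhds ?_ (by simp)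
    refine ENNReal.Tendsto.mul_const ?_ (Or.inr (by finiteness))
    refine ENNReal.tendsto_pow_atTop_nhds_zero_of_lt_one ?_
    rw [ENNReal.div_lt_iff (by simp) (by simp)]
    norm_num
  rw [zero_mul, tsub_zero] at hlim
  exact le_of_tendsto' hlim fun T => (decode_success_ge hR hA le_rfl T).trans
    (outcomeProb_mono fun _ _ h => h.1)

theorem Decodable.outcomeProb_ge (hR : 0 < R) (hA : Decodable A d) {k : ℕ}
    (hk : (signalSupport d).card ≤ k) :
    ENNReal.ofReal (1 - (1 / 2) ^ k) ≤ outcomeProb A (measure A d)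
      fun dhat ops => dhat = d ∧ ops ≤ μ * R + 16 * R * (8 * k) := by
  -- The choice `T = 8 * k` works because `2 * (5/6) ^ 8 < 1/2`.
  refine le_trans ?_ (decode_success_ge hR hA hk (8 * k))
  rw [ENNReal.ofReal_sub _ (by positivity), ENNReal.ofReal_one]
  refine tsub_le_tsub_left ?_ 1
  rw [pow_mul, ← mul_pow, ENNReal.ofReal_pow (by norm_num)]
  gcongr
  rw [ENNReal.le_ofReal_iff_toReal_le (by finiteness) (by norm_num)]
  simp only [ENNReal.toReal_div, ENNReal.toReal_mul, ENNReal.toReal_pow,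
            ENNReal.toReal_ofNat]
  norm_num

end Progress

/-! ### Uniform probability on finite types -/

section Frequency

open Classical in
/-- The probability of `p` under the uniform distribution on a finite type. -/
def freq {α : Type*} [Fintype α] (p : α → Prop) : ℝ :=
  (univ.filter p).card / Fintype.card α

variable {α β : Type*} [Fintype α] [Fintype β]

theorem freq_eq (p : α → Prop) [DecidablePred p] :
    freq p = (univ.filter p).card / Fintype.card α := by
  unfold freq
  congr!

theorem ensembleProb_eq_freq {M n R μ : ℕ} (p : Design M n R μ → Prop) :
    ensembleProb p = freq p := by
  rw [ensembleProb, ensembleMean, freq, sum_boole]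

theorem freq_nonneg (p : α → Prop) : 0 ≤ freq p := by
  unfold freq
  positivity

theorem freq_mono {p q : α → Prop} (h : ∀ a, p a → q a) : freq p ≤ freq q := by
  classical
  rw [freq_eq, freq_eq]
  gcongr with x
  exact h x

theorem freq_or_le (p q : α → Prop) : freq (fun a => p a ∨ q a) ≤ freq p + freq q := by
  classical
  rw [freq_eq, freq_eq, freq_eq, ← add_div]
  gcongr
  rw [filter_or]
  exact_mod_cast card_union_le _ _

theorem freq_exists_le {ι : Type*} (s : Finset ι) (p : ι → α → Prop) :
    freq (fun a => ∃ i ∈ s, p i a) ≤ ∑ i ∈ s, freq (p i) := by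
  classical
  simp only [freq_eq]
  rw [← sum_div]
  gcongr
  have : (univ.filter fun a => ∃ i ∈ s, p i a) = s.biUnion fun i => univ.filter (p i) := by
    ext a; simp
  rw [this]
  exact_mod_cast card_biUnion_le

theorem freq_not [Nonempty α] (p : α → Prop) : freq (fun a => ¬ p a) = 1 - freq p := by
  classical
  have h : (Fintype.card α : ℝ) ≠ 0 := by simp
  have hc := card_filter_add_card_filter_not (s := (univ : Finset α)) p
  rw [freq_eq, freq_eq, eq_sub_iff_add_eq, ← add_div, div_eq_one_iff_eq h, ← card_univ, ← hc]
  push_cast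
  ring

theorem freq_prod_le (p : α → Prop) (q : α → β → Prop) {b : ℝ} (h : ∀ a, p a → freq (q a) ≤ b) :
    freq (fun ω : α × β => p ω.1 ∧ q ω.1 ω.2) ≤ freq p * b := by
  classical
  have hcard : ((univ.filter fun ω : α × β => p ω.1 ∧ q ω.1 ω.2).card : ℝ) =
      ∑ a ∈ univ.filter p, ((univ.filter (q a)).card : ℝ) := by
    rw [card_filter, Fintype.sum_prod_type, sum_filter]
    push_cast
    refine sum_congr rfl fun a _ => ?_
    by_cases ha : p a <;> simp [ha]
  -- For empty `β` the left side is zero; `b` is nonnegative as soon as some `a` satisfies `p`, and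
  -- otherwise the right side vanishes.
  rcases isEmpty_or_nonempty β with hβ | hβ
  · rcases isEmpty_or_nonempty {a // p a} with hp | ⟨⟨a, ha⟩⟩
    · have : ∀ a, ¬ p a := fun a ha => hp.false ⟨a, ha⟩
      simp [freq_eq, this]
    · have hb : 0 ≤ b := (freq_nonneg _).trans (h a ha)
      have := mul_nonneg (freq_nonneg p) hb
      simpa [freq_eq] using this
  have hβ0 : (0 : ℝ) < Fintype.card β := by exact_mod_cast Fintype.card_pos
  rw [freq_eq, freq_eq, hcard, Fintype.card_prod, Nat.cast_mul, div_mul_eq_mul_div, ← div_div,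
    div_right_comm]
  gcongr
  rw [div_le_iff₀ hβ0, mul_assoc, ← nsmul_eq_mul]
  refine sum_le_card_nsmul _ _ _ fun a ha => ?_
  have := h a (mem_filter.1 ha).2
  rwa [freq, div_le_iff₀ hβ0] at this

theorem freq_fst_le (p : α → Prop) : freq (fun ω : α × β => p ω.1) ≤ freq p := by
  classical
  have := freq_prod_le p (fun _ (_ : β) => True) (b := 1) fun a _ => by
    simp only [freq_eq, filter_true, card_univ]
    exact div_self_le_one _
  simpa using this

theorem freq_pi {ι : Type*} [Fintype ι] [DecidableEq ι] [Nonempty α] (E : Finset ι)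
    (p : α → Prop) : freq (fun g : ι → α => ∀ j ∈ E, p (g j)) = freq p ^ E.card := by
  classical
  have h : (univ.filter fun g : ι → α => ∀ j ∈ E, p (g j)) =
      Fintype.piFinset fun j => if j ∈ E then univ.filter p else univ := by
    ext g
    simp only [mem_filter, mem_univ, true_and, Fintype.mem_piFinset]
    refine forall_congr' fun j => ?_
    by_cases hj : j ∈ E <;> simp [hj]
  have h0 : (Fintype.card α : ℝ) ≠ 0 := by simp
  rw [freq_eq, freq_eq, h, Fintype.card_piFinset, Fintype.card_pi, Nat.cast_prod, Nat.cast_prod,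
    ← prod_div_distrib, ← prod_const]
  rw [← prod_subset (subset_univ E) fun j _ hj => by simp [hj]]
  exact prod_congr rfl fun j hj => by simp [hj]

/-- A condition on random distinct values that leaves at most `m` possibilities for the value at
`e`, given the other values, is unlikely. -/
theorem freq_embedding_le {γ : Type*} [DecidableEq α] (e : α) (Q : (α ↪ β) → Prop)
    (f : β → γ) (m : Finset γ) (hm : ∀ b, f b ∈ m) (hcard : Fintype.card α ≤ Fintype.card β)
    (h : ∀ w w', Q w → Q w' → (∀ x ≠ e, w x = w' x) → f (w e) = f (w' e) → w e = w' e) :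
    freq Q ≤ m.card / (Fintype.card β - Fintype.card α + 1) := by
  classical
  obtain ⟨N, hN⟩ : ∃ N, Fintype.card α = N + 1 :=
    ⟨Fintype.card α - 1, by have := Fintype.card_pos_iff.2 ⟨e⟩; omega⟩
  have hrest : Fintype.card {x // x ≠ e} = N := by
    rw [Fintype.card_subtype_compl, hN]; simp
  -- An assignment in `Q` is determined by its restriction off `e` together with `f (w e)`. Compared
  -- with all embeddings, the factor `|β| - N` for the value at `e` is replaced by `|m|`.
  have hcount : (univ.filter Q).card ≤ m.card * (Fintype.card β).descFactorial N := by
    rw [← hrest, ← Fintype.card_embedding_eq, ← card_univ, ← card_product]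
    refine card_le_card_of_injOn
      (fun w => (f (w e), (Function.Embedding.subtype fun x => x ≠ e).trans w)) ?_ ?_
    · intro w _
      simp [hm]
    · intro w hw w' hw' heq
      simp only [Prod.mk.injEq] at heq
      have hx : ∀ x ≠ e, w x = w' x := fun x hx => DFunLike.congr_fun heq.2 ⟨x, hx⟩
      have he := h w w' (by simpa using hw) (by simpa using hw') hx heq.1
      ext x
      by_cases hxe : x = e
      · rw [hxe, he]
      · rw [hx x hxe]
  have hpos : 0 < (Fintype.card β).descFactorial N := Nat.descFactorial_pos.2 (by omega)
  rw [freq_eq, Fintype.card_embedding_eq, hN, Nat.descFactorial_succ]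
  have hsub : ((Fintype.card β - N : ℕ) : ℝ) = Fintype.card β - ((N + 1 : ℕ) : ℝ) + 1 := by
    rw [Nat.cast_sub (by omega)]; push_cast; ring
  rw [← hsub, div_le_div_iff₀]
  · have : ((univ.filter Q).card : ℝ) ≤ m.card * (Fintype.card β).descFactorial N := by
      exact_mod_cast hcount
    push_cast
    calc _ ≤ (m.card * (Fintype.card β).descFactorial N : ℝ) * ((Fintype.card β - N : ℕ) : ℝ) := by
          gcongr
      _ = _ := by ring
  · have : 0 < Fintype.card β - N := by omega
    positivity
  · have : 0 < Fintype.card β - N := by omega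
    positivity

theorem freq_triple_subset_le {μ : ℕ} (V : Finset (Fin μ)) (hμ : 3 ≤ μ) :
    freq (fun t : Fin 3 ↪ Fin μ => ∀ l, t l ∈ V) ≤ ((V.card : ℝ) / μ) ^ 3 := by
  classical
  have hc : (univ.filter fun t : Fin 3 ↪ Fin μ => ∀ l, t l ∈ V).card ≤ V.card.descFactorial 3 := by
    have : Fintype.card (Fin 3 ↪ V) = V.card.descFactorial 3 := by
      rw [Fintype.card_embedding_eq]; simp
    rw [← this, ← card_univ]
    have hsub : (univ.filter fun t : Fin 3 ↪ Fin μ => ∀ l, t l ∈ V) ⊆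
        univ.image fun t : Fin 3 ↪ V => t.trans (Function.Embedding.subtype _) := by
      intro t ht
      have ht : ∀ l, t l ∈ V := by simpa using ht
      exact mem_image.2 ⟨t.codRestrict V ht, mem_univ _, by ext; rfl⟩
    exact (card_le_card hsub).trans card_image_le
  have hv : V.card ≤ μ := by simpa using card_le_univ V
  have hall : Fintype.card (Fin 3 ↪ Fin μ) = μ.descFactorial 3 := by
    rw [Fintype.card_embedding_eq]; simp
  generalize V.card = v at hc hv ⊢
  rw [freq_eq, hall, div_pow, div_le_div_iff₀ (by exact_mod_cast Nat.descFactorial_pos.2 hμ)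
    (by positivity)]
  -- Drawing without replacement can only lower the probability: `(v - t) / (μ - t) ≤ v / μ` for `v
  -- ≤ μ`.
  have key : v.descFactorial 3 * μ ^ 3 ≤ v ^ 3 * μ.descFactorial 3 := by
    simp only [Nat.descFactorial_succ, Nat.descFactorial_zero, mul_one, Nat.sub_zero]
    have h1 : (v - 1) * μ ≤ v * (μ - 1) := by
      rw [Nat.sub_mul, Nat.mul_sub]; omega
    have h2 : (v - 2) * μ ≤ v * (μ - 2) := by
      rw [Nat.sub_mul, Nat.mul_sub]; omega
    calc (v - 2) * ((v - 1) * v) * μ ^ 3 = ((v - 2) * μ) * ((v - 1) * μ) * (v * μ) := by ring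
      _ ≤ (v * (μ - 2)) * (v * (μ - 1)) * (v * μ) := by gcongr
      _ = _ := by ring
  exact_mod_cast (Nat.mul_le_mul_right _ hc).trans key

theorem freq_triple_apply {μ : ℕ} (hμ : 3 ≤ μ) (l : Fin 3) (i : Fin μ) :
    freq (fun t : Fin 3 ↪ Fin μ => t l = i) = 1 / μ := by
  classical
  have hne : Nonempty (Fin 3 ↪ Fin μ) := ⟨Fin.castLEEmb hμ⟩
  have hT : (0 : ℝ) < Fintype.card (Fin 3 ↪ Fin μ) := by exact_mod_cast Fintype.card_pos
  -- Swapping two right vertices shows that all values of `t l` are equally likely.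
  have hsame : ∀ i', (univ.filter fun t : Fin 3 ↪ Fin μ => t l = i').card =
      (univ.filter fun t : Fin 3 ↪ Fin μ => t l = i).card := by
    intro i'
    refine card_bijective (fun t => t.trans (Equiv.swap i i').toEmbedding) ?_ ?_
    · exact ((Equiv.refl (Fin 3)).embeddingCongr (Equiv.swap i i')).bijective
    · intro t
      simp only [mem_filter, mem_univ, true_and, Function.Embedding.trans_apply,
        Equiv.coe_toEmbedding]
      rw [Equiv.swap_apply_eq_iff, Equiv.swap_apply_left]
  have hsum := card_eq_sum_card_fiberwise (f := fun t : Fin 3 ↪ Fin μ => t l) (s := univ)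
    (t := univ) (fun _ _ => mem_coe.2 (mem_univ _))
  simp only [hsame, sum_const, card_univ, smul_eq_mul, Fintype.card_fin] at hsum
  rw [freq_eq, div_eq_div_iff hT.ne' (by positivity), one_mul, hsum]
  push_cast
  ring

theorem freq_triple_mem_le {μ : ℕ} (hμ : 3 ≤ μ) (i : Fin μ) :
    freq (fun t : Fin 3 ↪ Fin μ => ∃ l, t l = i) ≤ 3 / μ := by
  have := freq_exists_le (univ : Finset (Fin 3)) fun l (t : Fin 3 ↪ Fin μ) => t l = i
  simp only [mem_univ, true_and, freq_triple_apply hμ, sum_const, card_univ, Fintype.card_fin,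
    nsmul_eq_mul] at this
  refine this.trans (le_of_eq ?_)
  push_cast
  ring

end Frequency

/-! ### Numerical estimates and the number of coprime vectors -/

section Counting

/-- The bound telescopes, since `1 / (M + 1) ^ 3` is at most half of `1 / M - 1 / (M + 1)`; the term
`1 / M` is kept for the induction. -/
theorem sum_inv_pow_le {R : ℕ} (hR : 3 ≤ R) {M : ℕ} (hM : 1 ≤ M) :
    ∑ t ∈ Icc 2 M, (1 / (t : ℝ)) ^ R ≤ 1 / 2 * (1 - 1 / M) := by
  induction M, hM using Nat.le_induction with
  | base => simp
  | succ M hM ih =>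
    rw [sum_Icc_succ_top (by omega)]
    have hM' : (1 : ℝ) ≤ M := by exact_mod_cast hM
    have h1 : (1 / ((M + 1 : ℕ) : ℝ)) ^ R ≤ (1 / ((M + 1 : ℕ) : ℝ)) ^ 3 := by
      apply pow_le_pow_of_le_one (by positivity) _ hR
      rw [div_le_one (by positivity)]
      push_cast
      linarith
    have h2 : (1 / ((M + 1 : ℕ) : ℝ)) ^ 3 ≤ 1 / 2 * (1 / M - 1 / ((M + 1 : ℕ) : ℝ)) := by
      push_cast
      have : (1 : ℝ) / M - 1 / (M + 1) = 1 / (M * (M + 1)) := by field_simp; ring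
      rw [this, div_pow, one_pow, div_mul_div_comm, one_mul,
        div_le_div_iff₀ (by positivity) (by positivity)]
      nlinarith [mul_nonneg (by positivity : (0 : ℝ) ≤ (M + 1) ^ 2) (sub_nonneg.2 hM')]
    linarith

theorem mem_coprimeVectors {M R : ℕ} {v : Fin R → ℕ} :
    v ∈ coprimeVectors M R ↔ (∀ r, v r ∈ Icc 1 M) ∧ univ.gcd v = 1 := by
  simp [coprimeVectors]

/-- A vector that is not coprime has all entries divisible by some `t ≥ 2`. There are `(M / t) ^ R`
vectors for each `t`, in total at most half of the cube. -/
theorem pow_le_two_mul_card_coprimeVectors {M R : ℕ} (hM : 1 ≤ M) (hR : 3 ≤ R) :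
    (M : ℝ) ^ R ≤ 2 * (coprimeVectors M R).card := by
  have hsub : (Fintype.piFinset fun _ : Fin R => Icc 1 M) ⊆ coprimeVectors M R ∪
      (Icc 2 M).biUnion fun t => Fintype.piFinset fun _ : Fin R => (Icc 1 M).filter (t ∣ ·) := by
    intro v hv
    rw [mem_union]
    have hv' : ∀ r, v r ∈ Icc 1 M := by simpa using hv
    by_cases hg : univ.gcd v = 1
    · exact Or.inl (mem_coprimeVectors.2 ⟨hv', hg⟩)
    · right
      have hr := mem_Icc.1 (hv' ⟨0, by omega⟩)
      have hdvd : univ.gcd v ∣ v ⟨0, by omega⟩ := gcd_dvd (mem_univ _)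
      have hle := Nat.le_of_dvd (by omega) hdvd
      have hpos := Nat.pos_of_dvd_of_pos hdvd (by omega)
      refine mem_biUnion.2 ⟨univ.gcd v, mem_Icc.2 ⟨by omega, by omega⟩, ?_⟩
      exact Fintype.mem_piFinset.2 fun r => mem_filter.2 ⟨hv' r, gcd_dvd (mem_univ _)⟩
  have hcard : M ^ R ≤ (coprimeVectors M R).card + ∑ t ∈ Icc 2 M, (M / t) ^ R := by
    have h1 := (card_le_card hsub).trans ((card_union_le _ _).trans
      (Nat.add_le_add_left card_biUnion_le _))
    have h2 : ∀ t, ((Icc 1 M).filter (t ∣ ·)).card = M / t := fun t =>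
      Nat.Ioc_filter_dvd_card_eq_div M t
    simpa [Fintype.card_piFinset, h2] using h1
  have hsum : ((∑ t ∈ Icc 2 M, (M / t) ^ R : ℕ) : ℝ) ≤ (M : ℝ) ^ R * (1 / 2) := by
    push_cast
    calc ∑ t ∈ Icc 2 M, ((M / t : ℕ) : ℝ) ^ R
        ≤ ∑ t ∈ Icc 2 M, (M : ℝ) ^ R * (1 / (t : ℝ)) ^ R := by
          refine sum_le_sum fun t _ => ?_
          rw [← mul_pow, mul_one_div]
          gcongr
          exact Nat.cast_div_le
      _ = (M : ℝ) ^ R * ∑ t ∈ Icc 2 M, (1 / (t : ℝ)) ^ R := by rw [mul_sum]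
      _ ≤ (M : ℝ) ^ R * (1 / 2) := by
          gcongr
          refine (sum_inv_pow_le hR hM).trans ?_
          have : (0 : ℝ) ≤ 1 / M := by positivity
          linarith
  have : (M : ℝ) ^ R ≤ (coprimeVectors M R).card + ((∑ t ∈ Icc 2 M, (M / t) ^ R : ℕ) : ℝ) := by
    exact_mod_cast hcard
  linarith

theorem zeta_re_bounds {R : ℕ} (hR : 2 ≤ R) :
    1 ≤ (riemannZeta R).re ∧ (riemannZeta R).re ≤ 2 := by
  have hre : (riemannZeta R).re = ∑' m : ℕ, 1 / (m : ℝ) ^ R := by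
    rw [zeta_nat_eq_tsum_of_gt_one (by omega)]
    have : ∀ m : ℕ, (1 : ℂ) / (m : ℂ) ^ R = ((1 / (m : ℝ) ^ R : ℝ) : ℂ) := fun m => by push_cast; rfl
    simp_rw [this]
    rw [← Complex.ofReal_tsum, Complex.ofReal_re]
  have hs : Summable fun m : ℕ => 1 / (m : ℝ) ^ R :=
    Real.summable_one_div_nat_pow.2 (by omega)
  rw [hre]
  constructor
  · simpa using hs.le_tsum 1 fun m _ => by positivity
  · calc ∑' m : ℕ, 1 / (m : ℝ) ^ R ≤ ∑' m : ℕ, 1 / (m : ℝ) ^ 2 := by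
          refine hs.tsum_le_tsum (fun m => ?_) hasSum_zeta_two.summable
          rcases Nat.eq_zero_or_pos m with rfl | hm
          · simp [show R ≠ 0 by omega]
          · have : (1 : ℝ) ≤ m := by exact_mod_cast hm
            gcongr
      _ = Real.pi ^ 2 / 6 := hasSum_zeta_two.tsum_eq
      _ ≤ 2 := by
          have := Real.pi_lt_d2
          have := Real.pi_pos
          nlinarith

theorem one_le_ceil_log {M n L : ℕ} (hM : 2 ≤ M) (hn : 2 ≤ n)
    (hL : L = ⌈Real.log n / Real.log M⌉₊) : 1 ≤ L ∧ n ≤ M ^ L := by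
  have hM' : (1 : ℝ) < M := by exact_mod_cast hM
  have hn' : (1 : ℝ) < n := by exact_mod_cast hn
  have hlM := Real.log_pos hM'
  refine ⟨?_, ?_⟩
  · rw [hL, Nat.one_le_ceil_iff]
    exact div_pos (Real.log_pos hn') hlM
  · have h : Real.log n / Real.log M ≤ L := by rw [hL]; exact Nat.le_ceil _
    rw [div_le_iff₀ hlM, ← Real.log_pow] at h
    have := (Real.log_le_log_iff (by linarith) (by positivity)).1 h
    exact_mod_cast this

theorem mul_le_pow_of_ceil_log {M n L R : ℕ} (hM : 2 ≤ M) (hn : 2 ≤ n)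
    (hL : L = ⌈Real.log n / Real.log M⌉₊) (hR : 216 * L ≤ R) :
    1024 * (n ^ 3 * M) ≤ M ^ R := by
  obtain ⟨hL1, hnL⟩ := one_le_ceil_log hM hn hL
  have hML : M ≤ M ^ L := Nat.le_self_pow (by omega) M
  calc 1024 * (n ^ 3 * M) = 2 ^ 10 * (n ^ 3 * M) := by norm_num
    -- Each of `2`, `n` and `M` is at most `M ^ L`.
    _ ≤ (M ^ L) ^ 10 * ((M ^ L) ^ 3 * M ^ L) := by
        gcongr
        exact hM.trans hML
    _ = M ^ (14 * L) := by ring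
    _ ≤ M ^ R := Nat.pow_le_pow_right (by omega) (by omega)

theorem pow_self_le_three_pow_mul_factorial (m : ℕ) : (m : ℝ) ^ m ≤ 3 ^ m * m.factorial := by
  have h := Real.pow_div_factorial_le_exp (m : ℝ) (by positivity) m
  rw [div_le_iff₀ (by positivity)] at h
  refine h.trans ?_
  gcongr
  rw [← Real.exp_one_pow]
  gcongr
  have := Real.exp_one_lt_d9
  linarith

theorem one_add_inv_pow_le_three {k m : ℕ} (hm : m ≤ k) : (1 + 1 / (k : ℝ)) ^ m ≤ 3 := by
  rcases Nat.eq_zero_or_pos k with rfl | hk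
  · simp [Nat.le_zero.1 hm]
  have hk' : (0 : ℝ) < k := by exact_mod_cast hk
  calc (1 + 1 / (k : ℝ)) ^ m ≤ (1 + 1 / (k : ℝ)) ^ k :=
        pow_le_pow_right₀ (by have : 0 ≤ 1 / (k : ℝ) := by positivity
                              linarith) hm
    _ ≤ Real.exp (1 / k) ^ k := by
        gcongr
        linarith [Real.add_one_le_exp (1 / (k : ℝ))]
    _ = Real.exp 1 := by
        rw [← Real.exp_nat_mul, mul_one_div_cancel hk'.ne']
    _ ≤ 3 := by
        have := Real.exp_one_lt_d9
        linarith

/-- With `m ^ m ≤ 3 ^ m * m!` all factorials cancel and `(54 * k / μ) ^ s * (2 * s / μ)` remains.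
The constant `216 = 4 * 54` makes the base at most `1/4`, and `s ≤ 2 ^ s` absorbs the factor `s`. -/
theorem expansion_term_le {k μ s : ℕ} (hk : 1 ≤ k) (hμ : 216 * k ≤ μ) (hs : 1 ≤ s) :
    (k.choose s : ℝ) * μ.choose (2 * s - 1) * ((((2 * s - 1 : ℕ) : ℝ) / μ) ^ 3) ^ s ≤
      (1 / 2) ^ s * (2 / μ) := by
  have hμ0 : (0 : ℝ) < μ := by exact_mod_cast (by omega : 0 < μ)
  have h1 : (k.choose s : ℝ) ≤ k ^ s / s.factorial := Nat.choose_le_pow_div s k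
  have h2 : (μ.choose (2 * s - 1) : ℝ) ≤ 2 * s * μ ^ (2 * s) / (μ * (2 * s).factorial) := by
    refine (Nat.choose_le_pow_div (2 * s - 1) μ).trans (le_of_eq ?_)
    obtain ⟨t, ht⟩ : ∃ t, 2 * s = t + 1 := ⟨2 * s - 1, by omega⟩
    have hts : (2 : ℝ) * s = t + 1 := by exact_mod_cast ht
    rw [ht, hts, Nat.factorial_succ, Nat.add_sub_cancel]
    push_cast
    field_simp
    ring
  have h3 : ((2 * s : ℝ)) ^ (3 * s) ≤ 54 ^ s * s.factorial * (2 * s).factorial := by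
    have ha := pow_self_le_three_pow_mul_factorial s
    have hb := pow_self_le_three_pow_mul_factorial (2 * s)
    push_cast at hb
    calc ((2 * s : ℝ)) ^ (3 * s) = 2 ^ s * (s : ℝ) ^ s * (2 * s : ℝ) ^ (2 * s) := by ring
      _ ≤ 2 ^ s * (3 ^ s * s.factorial) * (3 ^ (2 * s) * (2 * s).factorial) := by gcongr
      _ = 54 ^ s * s.factorial * (2 * s).factorial := by
          rw [show (54 : ℝ) = 2 * 3 * 3 ^ 2 by norm_num, mul_pow, mul_pow, ← pow_mul]
          ring
  have h4 : ((((2 * s - 1 : ℕ) : ℝ) / μ) ^ 3) ^ s ≤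
      54 ^ s * s.factorial * (2 * s).factorial / μ ^ (3 * s) := by
    rw [← pow_mul, div_pow]
    gcongr
    refine le_trans ?_ h3
    gcongr
    exact_mod_cast (by omega : 2 * s - 1 ≤ 2 * s)
  have h5 : (54 * k / μ : ℝ) ≤ 1 / 4 := by
    rw [div_le_iff₀ hμ0]
    have : (216 * k : ℝ) ≤ μ := by exact_mod_cast hμ
    linarith
  have h6 : (s : ℝ) ≤ 2 ^ s := by exact_mod_cast Nat.lt_two_pow_self.le
  calc (k.choose s : ℝ) * μ.choose (2 * s - 1) * ((((2 * s - 1 : ℕ) : ℝ) / μ) ^ 3) ^ s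
      ≤ (k ^ s / s.factorial) * (2 * s * μ ^ (2 * s) / (μ * (2 * s).factorial)) *
        (54 ^ s * s.factorial * (2 * s).factorial / μ ^ (3 * s)) := by gcongr
    _ = (54 * k / μ) ^ s * (2 * s / μ) := by
        have hf : (s.factorial : ℝ) ≠ 0 := by positivity
        have hf2 : ((2 * s).factorial : ℝ) ≠ 0 := by positivity
        rw [div_pow, mul_pow]
        field_simp
        ring
    _ ≤ (1 / 4) ^ s * (2 * 2 ^ s / μ) := by gcongr
    _ = (1 / 2) ^ s * (2 / μ) := by
        rw [show (1 / 2 : ℝ) = 1 / 4 * 2 by norm_num, mul_pow]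
        ring

theorem sum_half_pow_le (k : ℕ) : ∑ s ∈ Icc 1 k, (1 / 2 : ℝ) ^ s ≤ 1 := by
  have : ∑ s ∈ Icc 1 k, (1 / 2 : ℝ) ^ s = 1 - (1 / 2) ^ k := by
    induction k with
    | zero => simp
    | succ k ih => rw [sum_Icc_succ_top (by omega), ih]; ring
  rw [this]
  have : (0 : ℝ) ≤ (1 / 2) ^ k := by positivity
  linarith

end Counting

/-! ### The random matrix is decodable with high probability -/

section Ensemble

variable {M n R μ : ℕ}

theorem Design.matrix_apply_of_eq (ω : Design M n R μ) {i : Fin μ} {j : Fin n} {l : Fin 3}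
    (h : ω.1 j l = i) (r : Fin R) : ω.matrix (i, r) j = (ω.2 (j, l)).1 r := by
  rw [Design.matrix, Matrix.of_apply, sum_eq_single l]
  · simp [h]
  · intro l' _ hl
    rw [if_neg]
    intro h'
    exact hl ((ω.1 j).injective (h'.trans h.symm))
  · simp

theorem Design.matrix_apply_eq_zero (ω : Design M n R μ) {i : Fin μ} {j : Fin n}
    (h : ∀ l, ω.1 j l ≠ i) (r : Fin R) : ω.matrix (i, r) j = 0 := by
  simp [Design.matrix, h]

theorem Design.weight_mem (ω : Design M n R μ) (e : Fin n × Fin 3) (r : Fin R) :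
    (ω.2 e).1 r ∈ Icc 1 M := (mem_coprimeVectors.1 (ω.2 e).2).1 r

theorem Design.mem_nbrs (hR : 0 < R) (ω : Design M n R μ) (i : Fin μ) (j : Fin n) :
    i ∈ nbrs ω.matrix j ↔ ∃ l, ω.1 j l = i := by
  simp only [nbrs, mem_filter, mem_univ, true_and]
  constructor
  · rintro ⟨r, hr⟩
    by_contra! hn
    exact hr (ω.matrix_apply_eq_zero hn r)
  · rintro ⟨l, hl⟩
    refine ⟨⟨0, hR⟩, ?_⟩
    rw [ω.matrix_apply_of_eq hl]
    have := mem_Icc.1 (ω.weight_mem (j, l) ⟨0, hR⟩)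
    omega

theorem Design.nbrs_eq (hR : 0 < R) (ω : Design M n R μ) (j : Fin n) :
    nbrs ω.matrix j = univ.map (ω.1 j) := by
  ext i
  simp [ω.mem_nbrs hR]

/-- The random graph expands by a factor of two on all sets of at most `k` fixed columns. -/
theorem freq_not_expanding_le {k : ℕ} (hk : 1 ≤ k) (hμ : 216 * k ≤ μ) (S : Finset (Fin n))
    (hS : S.card ≤ k) :
    freq (fun g : Fin n → Fin 3 ↪ Fin μ =>
      ¬ ∀ E ⊆ S, 2 * E.card ≤ (E.biUnion fun j => univ.map (g j)).card) ≤ 2 / μ := by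
  have hne : Nonempty (Fin 3 ↪ Fin μ) := ⟨Fin.castLEEmb (by omega)⟩
  have hcover : ∀ g : Fin n → Fin 3 ↪ Fin μ,
      (¬ ∀ E ⊆ S, 2 * E.card ≤ (E.biUnion fun j => univ.map (g j)).card) →
      ∃ s ∈ Icc 1 k, ∃ E ∈ S.powersetCard s, ∃ V ∈ (univ : Finset (Fin μ)).powersetCard (2 * s - 1),
        ∀ j ∈ E, ∀ l, g j l ∈ V := by
    intro g hg
    push Not at hg
    obtain ⟨E, hE, hlt⟩ := hg
    have hEk := card_le_card hE
    -- A neighbourhood that is too small is enlarged to exactly `2|E| - 1` vertices, so that the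
    -- union bound runs over sets of one size.
    obtain ⟨V, hsub, -, hV⟩ := exists_subsuperset_card_eq (subset_univ
      (E.biUnion fun j => univ.map (g j))) (n := 2 * E.card - 1) (by omega) (by simp; omega)
    refine ⟨E.card, mem_Icc.2 ⟨by omega, by omega⟩, E, mem_powersetCard.2 ⟨hE, rfl⟩, V,
      mem_powersetCard.2 ⟨subset_univ _, hV⟩, fun j hj l => hsub ?_⟩
    exact mem_biUnion.2 ⟨j, hj, by simp⟩
  calc _ ≤ _ := freq_mono hcover
    _ ≤ ∑ s ∈ Icc 1 k, ∑ E ∈ S.powersetCard s,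
        ∑ V ∈ (univ : Finset (Fin μ)).powersetCard (2 * s - 1),
          freq (fun g : Fin n → Fin 3 ↪ Fin μ => ∀ j ∈ E, ∀ l, g j l ∈ V) :=
        (freq_exists_le _ _).trans (sum_le_sum fun s _ => (freq_exists_le _ _).trans
          (sum_le_sum fun E _ => freq_exists_le _ _))
    _ ≤ ∑ s ∈ Icc 1 k, ∑ E ∈ S.powersetCard s,
        ∑ V ∈ (univ : Finset (Fin μ)).powersetCard (2 * s - 1),
          ((((2 * s - 1 : ℕ) : ℝ) / μ) ^ 3) ^ s := by
        refine sum_le_sum fun s _ => sum_le_sum fun E hE => sum_le_sum fun V hV => ?_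
        rw [freq_pi E fun t : Fin 3 ↪ Fin μ => ∀ l, t l ∈ V, (mem_powersetCard.1 hE).2]
        gcongr
        · exact freq_nonneg _
        · rw [← (mem_powersetCard.1 hV).2]
          exact freq_triple_subset_le V (by omega)
    _ = ∑ s ∈ Icc 1 k, (S.card.choose s : ℝ) * μ.choose (2 * s - 1) *
          ((((2 * s - 1 : ℕ) : ℝ) / μ) ^ 3) ^ s := by
        simp [card_powersetCard, mul_assoc]
    _ ≤ ∑ s ∈ Icc 1 k, (1 / 2 : ℝ) ^ s * (2 / μ) := by
        refine sum_le_sum fun s hs => le_trans ?_ (expansion_term_le hk hμ (mem_Icc.1 hs).1)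
        gcongr
    _ ≤ 2 / μ := by
        rw [← sum_mul]
        exact mul_le_of_le_one_left (by positivity) (sum_half_pow_le k)

/-- The group `i` of the measurements of the columns in `J` is confused with the edge `(i, j')`. -/
def Confused (ω : Design M n R μ) (d : Fin n → ℝ) (i : Fin μ) (J : Finset (Fin n))
    (j' : Fin n) : Prop :=
  (∃ l, ω.1 j' l = i) ∧ (∃ j ∈ J, j ≠ j') ∧
    ∃ x : ℝ, ∀ r, ∑ j ∈ J, d j * (ω.matrix (i, r) j : ℝ) = x * ω.matrix (i, r) j'

/-- Only the weight of an edge `(i, j)` with `j ∈ J`, `j ≠ j'` is left random. Given the other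
weights and its first coordinate, confusion determines this weight, so at most `M` values remain. -/
theorem freq_confused_le (hR : 0 < R) (hC : 3 * n ≤ (coprimeVectors M R).card)
    (g : Fin n → Fin 3 ↪ Fin μ) (d : Fin n → ℝ) (i : Fin μ) (J : Finset (Fin n)) (j' : Fin n)
    (hJ : ∀ j ∈ J, ∃ l, g j l = i) (hd : ∀ j ∈ J, d j ≠ 0) :
    freq (fun w : Fin n × Fin 3 ↪ coprimeVectors M R => Confused (g, w) d i J j') ≤
      M / ((coprimeVectors M R).card - 3 * n + 1) := by
  have hC' : (3 * n : ℝ) ≤ (coprimeVectors M R).card := by exact_mod_cast hC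
  by_cases hex : (∃ l, g j' l = i) ∧ ∃ j ∈ J, j ≠ j'
  swap
  · have h0 : ∀ w : Fin n × Fin 3 ↪ coprimeVectors M R, ¬ Confused (g, w) d i J j' :=
      fun w hw => hex ⟨hw.1, hw.2.1⟩
    have : (0 : ℝ) ≤ (coprimeVectors M R).card - 3 * n + 1 := by linarith
    simp only [freq, h0, filter_false, card_empty, Nat.cast_zero, zero_div]
    positivity
  obtain ⟨⟨l', hl'⟩, j, hj, hjj'⟩ := hex
  obtain ⟨l, hl⟩ := hJ j hj
  have hcardα : Fintype.card (Fin n × Fin 3) = 3 * n := by simp [mul_comm]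
  have hcardC : Fintype.card (coprimeVectors M R) = (coprimeVectors M R).card :=
    Fintype.card_coe _
  have key := freq_embedding_le (j, l)
    (fun w : Fin n × Fin 3 ↪ coprimeVectors M R => Confused (g, w) d i J j')
    (fun v => v.1 ⟨0, hR⟩) (Icc 1 M) (fun v => (mem_coprimeVectors.1 v.2).1 _)
    (by rw [hcardα, hcardC]; exact hC) ?_
  · rw [hcardα, hcardC] at key
    simpa using key
  rintro w w' ⟨-, -, x, hx⟩ ⟨-, -, x', hx'⟩ hoff heq
  have hsame : ∀ j₁ ≠ j, ∀ r, Design.matrix (g, w) (i, r) j₁ = Design.matrix (g, w') (i, r) j₁ := by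
    intro j₁ hj₁ r
    simp only [Design.matrix, Matrix.of_apply]
    refine sum_congr rfl fun l₁ _ => ?_
    rw [hoff (j₁, l₁) fun h => hj₁ (congrArg Prod.fst h)]
  -- The two relations differ only in the column `j`; the column `j'` is the same in both because `j
  -- ≠ j'`.
  have hdiff : ∀ r, d j * (((w (j, l)).1 r : ℝ) - (w' (j, l)).1 r) =
      (x - x') * (w' (j', l')).1 r := by
    intro r
    have h1 := hx r
    have h2 := hx' r
    rw [← add_sum_erase J _ hj] at h1 h2
    rw [Design.matrix_apply_of_eq (g, w) hl, hsame j' (Ne.symm hjj'),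
      Design.matrix_apply_of_eq (g, w') hl',
      sum_congr rfl fun j₁ hj₁ => by rw [hsame j₁ (ne_of_mem_erase hj₁)]] at h1
    rw [Design.matrix_apply_of_eq (g, w') hl, Design.matrix_apply_of_eq (g, w') hl'] at h2
    dsimp only at h1 h2
    linear_combination h1 - h2
  -- The first coordinates of the two weights agree, while the first coordinate of the weight at
  -- `j'` is positive.
  have hx0 : x - x' = 0 := by
    have h0 := hdiff ⟨0, hR⟩
    have hpos := mem_Icc.1 (Design.weight_mem (g, w') (j', l') ⟨0, hR⟩)
    have hne : ((w' (j', l')).1 ⟨0, hR⟩ : ℝ) ≠ 0 := by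
      have : (w' (j', l')).1 ⟨0, hR⟩ ≠ 0 := by
        have := hpos.1
        dsimp only at this
        omega
      exact_mod_cast this
    rw [heq, sub_self, mul_zero] at h0
    exact (mul_eq_zero.1 h0.symm).resolve_right hne
  refine Subtype.ext (funext fun r => ?_)
  have h0 := hdiff r
  rw [hx0, zero_mul] at h0
  have := (mul_eq_zero.1 h0).resolve_left (hd j hj)
  exact_mod_cast sub_eq_zero.1 this

/-- Since `J` is nonempty, one factor `3 * k / μ ≤ 1` can be pulled out of `(3 * k / μ) ^ |J|`; the
remaining sum of `k ^ (-|J|)` over all subsets is `(1 + 1 / k) ^ |S| ≤ 3`. -/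
theorem sum_nonempty_pow_le {k : ℕ} (hk : 1 ≤ k) (hμ : 3 * k ≤ μ) (S : Finset (Fin n))
    (hS : S.card ≤ k) :
    ∑ J ∈ S.powerset.filter (fun J => J.Nonempty), (3 / (μ : ℝ)) ^ J.card ≤ 9 * k / μ := by
  have hk0 : (0 : ℝ) < k := by exact_mod_cast hk
  have hμ0 : (0 : ℝ) < μ := by exact_mod_cast (by omega : 0 < μ)
  have h1 : 3 * (k : ℝ) / μ ≤ 1 := by
    rw [div_le_one hμ0]
    exact_mod_cast hμ
  calc ∑ J ∈ S.powerset.filter (fun J => J.Nonempty), (3 / (μ : ℝ)) ^ J.card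
      ≤ ∑ J ∈ S.powerset.filter (fun J => J.Nonempty), 3 * (k : ℝ) / μ * (1 / k) ^ J.card := by
        refine sum_le_sum fun J hJ => ?_
        have hJ1 : J.card ≠ 0 := (card_pos.2 (mem_filter.1 hJ).2).ne'
        have : (3 / (μ : ℝ)) = 3 * k / μ * (1 / k) := by field_simp
        rw [this, mul_pow]
        gcongr
        exact pow_le_of_le_one (by positivity) h1 hJ1
    _ ≤ ∑ J ∈ S.powerset, 3 * (k : ℝ) / μ * (1 / k) ^ J.card :=
        sum_le_sum_of_subset_of_nonneg (filter_subset _ _) fun _ _ _ => by positivity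
    _ = 3 * (k : ℝ) / μ * (1 + 1 / k) ^ S.card := by
        rw [← mul_sum, add_comm, ← sum_pow_mul_eq_add_pow]
        simp
    _ ≤ 3 * (k : ℝ) / μ * 3 := by
        gcongr
        exact one_add_inv_pow_le_three hS
    _ = 9 * k / μ := by ring

/-- The graph is only required to join all of `J` to `i`, not to have `J` as the exact set of
neighbours, so the columns contribute independent factors `3 / μ`. -/
theorem freq_exists_confused_le (hR : 0 < R) (hC : 3 * n ≤ (coprimeVectors M R).card) {k : ℕ}
    (hk : 1 ≤ k) (hμ : 3 * k ≤ μ) (d : Fin n → ℝ) (hd : (signalSupport d).card ≤ k) :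
    freq (fun ω : Design M n R μ => ∃ i ∈ univ, ∃ J ∈ (signalSupport d).powerset.filter
        (fun J => J.Nonempty), ∃ j' ∈ univ, (∀ j ∈ J, ∃ l, ω.1 j l = i) ∧ Confused ω d i J j') ≤
      9 * k * n * (M / ((coprimeVectors M R).card - 3 * n + 1)) := by
  have hne : Nonempty (Fin 3 ↪ Fin μ) := ⟨Fin.castLEEmb (by omega)⟩
  have hμ0 : (0 : ℝ) < μ := by exact_mod_cast (by omega : 0 < μ)
  have hC' : (3 * n : ℝ) ≤ (coprimeVectors M R).card := by exact_mod_cast hC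
  set q : ℝ := M / ((coprimeVectors M R).card - 3 * n + 1)
  have hq : 0 ≤ q := div_nonneg (by positivity) (by linarith)
  calc _ ≤ ∑ i : Fin μ, ∑ J ∈ (signalSupport d).powerset.filter (fun J => J.Nonempty),
        ∑ j' : Fin n, freq (fun ω : Design M n R μ =>
          (∀ j ∈ J, ∃ l, ω.1 j l = i) ∧ Confused ω d i J j') :=
        (freq_exists_le _ _).trans (sum_le_sum fun i _ => (freq_exists_le _ _).trans
          (sum_le_sum fun J _ => freq_exists_le _ _))
    _ ≤ ∑ i : Fin μ, ∑ J ∈ (signalSupport d).powerset.filter (fun J => J.Nonempty),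
        ∑ j' : Fin n, (3 / (μ : ℝ)) ^ J.card * q := by
        refine sum_le_sum fun i _ => sum_le_sum fun J hJ => sum_le_sum fun j' _ => ?_
        have hJd : ∀ j ∈ J, d j ≠ 0 := fun j hj => by
          simpa [signalSupport] using mem_powerset.1 (mem_filter.1 hJ).1 hj
        refine (freq_prod_le (fun g : Fin n → Fin 3 ↪ Fin μ => ∀ j ∈ J, ∃ l, g j l = i)
          (fun g w => Confused (g, w) d i J j')
          fun g hg => freq_confused_le hR hC g d i J j' hg hJd).trans ?_
        rw [freq_pi J fun t : Fin 3 ↪ Fin μ => ∃ l, t l = i]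
        gcongr
        · exact freq_nonneg _
        · exact freq_triple_mem_le (by omega) i
    _ = μ * (n * (q * ∑ J ∈ (signalSupport d).powerset.filter (fun J => J.Nonempty),
          (3 / (μ : ℝ)) ^ J.card)) := by
        simp only [sum_const, card_univ, Fintype.card_fin, nsmul_eq_mul, mul_sum]
        refine sum_congr rfl fun J _ => ?_
        ring
    _ ≤ μ * (n * (q * (9 * k / μ))) := by
        gcongr
        exact sum_nonempty_pow_le hk hμ _ hd
    _ = 9 * k * n * q := by field_simp

theorem Design.decodable (hR : 0 < R) (ω : Design M n R μ) (d : Fin n → ℝ)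
    (hexp : ∀ E ⊆ signalSupport d, 2 * E.card ≤ (E.biUnion fun j => univ.map (ω.1 j)).card)
    (hconf : ¬ ∃ i ∈ univ, ∃ J ∈ (signalSupport d).powerset.filter
        (fun J => J.Nonempty), ∃ j' ∈ univ, (∀ j ∈ J, ∃ l, ω.1 j l = i) ∧ Confused ω d i J j') :
    Decodable ω.matrix d where
  entry_pos i j r hij := by
    obtain ⟨l, hl⟩ := (ω.mem_nbrs hR i j).1 hij
    rw [ω.matrix_apply_of_eq hl]
    exact (mem_Icc.1 (ω.weight_mem (j, l) r)).1
  card_nbrs j := by simp [ω.nbrs_eq hR]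
  expand E hE := by
    have : nbrs ω.matrix = fun j => univ.map (ω.1 j) := funext (ω.nbrs_eq hR)
    rw [this]
    exact hexp E hE
  distinguish i U hU j' hij' x hex hpar := by
    obtain ⟨j₀, hj₀, hij₀⟩ := hex
    by_contra hne
    set J := U.filter fun j => i ∈ nbrs ω.matrix j with hJ
    have hJne : J.Nonempty := ⟨j₀, mem_filter.2 ⟨hj₀, hij₀⟩⟩
    refine hconf ⟨i, mem_univ _, J, mem_filter.2 ⟨mem_powerset.2
      ((filter_subset _ _).trans hU), hJne⟩, j', mem_univ _,
      fun j hj => (ω.mem_nbrs hR i j).1 (mem_filter.1 hj).2, (ω.mem_nbrs hR i j').1 hij', ?_, x, ?_⟩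
    · by_contra! hall
      exact hne (eq_singleton_iff_nonempty_unique_mem.2 ⟨hJne, hall⟩)
    · intro r
      rw [← hpar r, hJ, sum_filter]
      refine sum_congr rfl fun j _ => ?_
      split_ifs with hn
      · rfl
      · simp [entry_eq_zero hn]

theorem mean_row_card_le (hμ : 3 ≤ μ) (p : Fin μ × Fin R) :
    ensembleMean (fun ω : Design M n R μ =>
      ((univ.filter fun j => ω.matrix p j ≠ 0).card : ℝ)) ≤ n * (3 / μ) := by
  classical
  have hne : Nonempty (Fin 3 ↪ Fin μ) := ⟨Fin.castLEEmb hμ⟩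
  have h : ensembleMean (fun ω : Design M n R μ =>
      ((univ.filter fun j => ω.matrix p j ≠ 0).card : ℝ)) =
      ∑ j, freq fun ω : Design M n R μ => ω.matrix p j ≠ 0 := by
    simp only [ensembleMean, freq_eq, ← sum_div]
    congr 1
    simp_rw [card_filter]
    push_cast
    exact sum_comm
  rw [h]
  refine (sum_le_card_nsmul univ _ (3 / (μ : ℝ)) fun j _ => ?_).trans (by simp)
  calc freq (fun ω : Design M n R μ => ω.matrix p j ≠ 0)
      ≤ freq (fun ω : Design M n R μ => ∀ j₁ ∈ ({j} : Finset (Fin n)), ∃ l, ω.1 j₁ l = p.1) := by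
        refine freq_mono fun ω hω => ?_
        simp only [mem_singleton, forall_eq]
        by_contra! hn
        exact hω (ω.matrix_apply_eq_zero hn p.2)
    _ ≤ _ := freq_fst_le fun g : Fin n → Fin 3 ↪ Fin μ =>
          ∀ j₁ ∈ ({j} : Finset (Fin n)), ∃ l, g j₁ l = p.1
    _ ≤ 3 / μ := by
        rw [freq_pi {j} fun t : Fin 3 ↪ Fin μ => ∃ l, t l = p.1, card_singleton, pow_one]
        exact freq_triple_mem_le hμ p.1

end Ensemble

theorem half_pow_le_inv {k : ℕ} (hk : 1 ≤ k) : (1 / 2 : ℝ) ^ k ≤ 1 / k := by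
  have hk0 : (0 : ℝ) < k := by exact_mod_cast hk
  rw [div_pow, one_pow]
  gcongr
  exact_mod_cast Nat.lt_two_pow_self.le

/-- A random matrix lets the decoder recover a fixed sparse signal with high probability. -/
theorem ensembleProb_decodable_ge {M n R μ k : ℕ} (hR : 0 < R) (hk : 1 ≤ k) (hkn : k ≤ n)
    (hμ : 216 * k ≤ μ) (hC : 512 * ((n : ℝ) ^ 3 * M) ≤ (coprimeVectors M R).card) (hM : 1 ≤ M)
    (d : Fin n → ℝ) (hd : (signalSupport d).card ≤ k) :
    1 - 3 / (k : ℝ) ≤ ensembleProb fun ω : Design M n R μ => Decodable ω.matrix d := by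
  classical
  have hk0 : (1 : ℝ) ≤ k := by exact_mod_cast hk
  have hkn' : (k : ℝ) ≤ n := by exact_mod_cast hkn
  have hM0 : (1 : ℝ) ≤ M := by exact_mod_cast hM
  have hn0 : (1 : ℝ) ≤ n := hk0.trans hkn'
  have hn3 : (n : ℝ) ≤ n ^ 3 * M := by
    calc (n : ℝ) ≤ n ^ 3 := le_self_pow₀ hn0 (by norm_num)
      _ ≤ n ^ 3 * M := le_mul_of_one_le_right (by positivity) hM0
  have hCn : 3 * n ≤ (coprimeVectors M R).card := by
    have : (3 * n : ℝ) ≤ (coprimeVectors M R).card := by linarith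
    exact_mod_cast this
  have hne1 : Nonempty (Fin 3 ↪ Fin μ) := ⟨Fin.castLEEmb (by omega)⟩
  have hne2 : Nonempty (Fin n × Fin 3 ↪ coprimeVectors M R) := by
    apply Function.Embedding.nonempty_of_card_le
    simp only [Fintype.card_prod, Fintype.card_fin, Fintype.card_coe]
    omega
  have hμk : (k : ℝ) ≤ μ := by exact_mod_cast (by omega : k ≤ μ)
  -- The denominator exceeds `256 * n ^ 3 * M`; one factor `n` remains and is compared with `k ≤ n`.
  have hq : 9 * k * n * ((M : ℝ) / ((coprimeVectors M R).card - 3 * n + 1)) ≤ 1 / k := by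
    have hden : 256 * ((n : ℝ) ^ 3 * M) ≤ (coprimeVectors M R).card - 3 * n + 1 := by linarith
    have hden0 : (0 : ℝ) < (coprimeVectors M R).card - 3 * n + 1 :=
      lt_of_lt_of_le (by positivity) hden
    calc 9 * k * n * ((M : ℝ) / ((coprimeVectors M R).card - 3 * n + 1))
        ≤ 9 * n * n * ((M : ℝ) / (256 * (n ^ 3 * M))) := by gcongr
      _ = 9 / 256 * (1 / n) := by field_simp
      _ ≤ 1 * (1 / k) := by
          gcongr
          norm_num
      _ = 1 / k := one_mul _
  have h1 := freq_not_expanding_le hk hμ (signalSupport d) hd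
  have h2 := freq_exists_confused_le (M := M) hR hCn hk (by omega : 3 * k ≤ μ) d hd
  have hfail : freq (fun ω : Design M n R μ => ¬ Decodable ω.matrix d) ≤ 3 / k := by
    calc freq (fun ω : Design M n R μ => ¬ Decodable ω.matrix d) ≤ _ := by
          refine freq_mono fun ω hω => ?_
          by_contra hn
          rw [not_or, not_not] at hn
          exact hω (ω.decodable hR d hn.1 hn.2)
      _ ≤ _ := freq_or_le _ _
      _ ≤ 2 / μ + 1 / k :=
          add_le_add ((freq_fst_le fun g : Fin n → Fin 3 ↪ Fin μ => ¬ ∀ E ⊆ signalSupport d,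
            2 * E.card ≤ (E.biUnion fun j => univ.map (g j)).card).trans h1) (h2.trans hq)
      _ ≤ 2 / k + 1 / k := by gcongr
      _ = 3 / k := by ring
  rw [freq_not] at hfail
  rw [ensembleProb_eq_freq]
  linarith

end ShoFaInt

end

/-! ### The main theorem -/

theorem mainTheorem1 :
    ∃ c K : ℝ, 0 < c ∧ 0 < K ∧
      ∀ (a : ℝ) (M n k R μ L : ℕ), 2 ≤ M → 2 ≤ n → 1 ≤ k → k ≤ n →
        L = ⌈Real.log n / Real.log M⌉₊ →
        c * L ≤ R → R ≤ a * L → c * k ≤ μ → μ ≤ a * k →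
        3 * (n : ℝ) ≤ (M : ℝ) ^ R / (riemannZeta R).re ∧
        3 * n ≤ (ShoFaInt.coprimeVectors M R).card ∧
        3 ≤ μ ∧
        (∀ d : Fin n → ℝ, (Finset.univ.filter fun j => d j ≠ 0).card ≤ k →
          1 - K / k ≤ ShoFaInt.ensembleProb fun ω : ShoFaInt.Design M n R μ =>
            ShoFaInt.outcomeProb ω.matrix (ShoFaInt.measure ω.matrix d)
              (fun dhat _ => dhat = d) = 1 ∧
            ENNReal.ofReal (1 - K / k) ≤
              ShoFaInt.outcomeProb ω.matrix (ShoFaInt.measure ω.matrix d)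
                (fun dhat ops => dhat = d ∧ (ops : ℝ) ≤ K * a ^ 2 * (k * L))) ∧
        ∀ p : Fin μ × Fin R,
          ShoFaInt.ensembleMean (fun ω : ShoFaInt.Design M n R μ =>
            ((Finset.univ.filter fun j => ω.matrix p j ≠ 0).card : ℝ)) ≤ K * (n / k) := by
  -- The value `216` is what the expansion estimate needs. The operation count is at most `a² k L +
  -- 128 a k L`, hence at most `129 a² k L` because `a ≥ 1`; `200` covers this, the failure
  -- probabilities `3 / k` and `1 / k`, and the row bound `3 n / k`.
  refine ⟨216, 200, by norm_num, by norm_num, ?_⟩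
  intro a M n k R μ L hM hn hk hkn hL hcR hRa hcμ hμa
  have hR : 216 * L ≤ R := by exact_mod_cast hcR
  have hμ : 216 * k ≤ μ := by exact_mod_cast hcμ
  have hL1 := (ShoFaInt.one_le_ceil_log hM hn hL).1
  have hpow := ShoFaInt.mul_le_pow_of_ceil_log hM hn hL hR
  have hpow' : 1024 * ((n : ℝ) ^ 3 * M) ≤ (M : ℝ) ^ R := by exact_mod_cast hpow
  have hk0 : (1 : ℝ) ≤ k := by exact_mod_cast hk
  have hL0 : (1 : ℝ) ≤ L := by exact_mod_cast hL1
  have hM0 : (1 : ℝ) ≤ M := by exact_mod_cast (by omega : 1 ≤ M)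
  have hn0 : (1 : ℝ) ≤ n := by exact_mod_cast (by omega : 1 ≤ n)
  have hn3 : (n : ℝ) ≤ n ^ 3 * M := by
    calc (n : ℝ) ≤ n ^ 3 := le_self_pow₀ hn0 (by norm_num)
      _ ≤ n ^ 3 * M := le_mul_of_one_le_right (by positivity) hM0
  have ha : 1 ≤ a := by
    have : 216 * (k : ℝ) ≤ a * k := hcμ.trans hμa
    have := le_of_mul_le_mul_right this (by linarith)
    linarith
  have hcard := ShoFaInt.pow_le_two_mul_card_coprimeVectors (M := M) (R := R) (by omega) (by omega)
  refine ⟨?_, ?_, by omega, ?_, ?_⟩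
  · obtain ⟨hz1, hz2⟩ := ShoFaInt.zeta_re_bounds (R := R) (by omega)
    rw [le_div_iff₀ (by linarith)]
    calc 3 * (n : ℝ) * (riemannZeta R).re ≤ 3 * n * 2 := by gcongr
      _ ≤ (M : ℝ) ^ R := by linarith
  · have : (3 * n : ℝ) ≤ (ShoFaInt.coprimeVectors M R).card := by linarith
    exact_mod_cast this
  · intro d hd
    have hprob := ShoFaInt.ensembleProb_decodable_ge (M := M) (R := R) (by omega) hk hkn hμ
      (by linarith) (by omega) d hd
    have hK : 1 - 200 / (k : ℝ) ≤ 1 - 3 / k := by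
      gcongr
      norm_num
    refine hK.trans (hprob.trans ?_)
    rw [ShoFaInt.ensembleProb_eq_freq, ShoFaInt.ensembleProb_eq_freq]
    refine ShoFaInt.freq_mono fun ω hω => ⟨hω.outcomeProb_eq_one (by omega), ?_⟩
    refine le_trans (ENNReal.ofReal_le_ofReal ?_) ((hω.outcomeProb_ge (by omega) hd).trans
      (ShoFaInt.outcomeProb_mono fun v t h => ⟨h.1, ?_⟩))
    · have h1 := ShoFaInt.half_pow_le_inv hk
      have h2 : 1 / (k : ℝ) ≤ 200 / k := by
        gcongr
        norm_num
      linarith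
    · have ht : (t : ℝ) ≤ μ * R + 16 * R * (8 * k) := by exact_mod_cast h.2
      have h1 : (μ : ℝ) * R ≤ (a * k) * (a * L) := by gcongr
      have h2 : 16 * (R : ℝ) * (8 * k) ≤ 16 * (a * L) * (8 * k) := by gcongr
      have h3 : a * (k * L) ≤ a ^ 2 * (k * L) := by
        gcongr
        exact le_self_pow₀ ha (by norm_num)
      have h4 : 0 ≤ a ^ 2 * ((k : ℝ) * L) := by positivity
      linarith
  · intro p
    refine (ShoFaInt.mean_row_card_le (by omega) p).trans ?_
    have hμk : (k : ℝ) ≤ μ := by exact_mod_cast (by omega : k ≤ μ)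
    calc (n : ℝ) * (3 / μ) ≤ n * (3 / k) := by gcongr
      _ = 3 * (n / k) := by ring
      _ ≤ 200 * (n / k) := by
          gcongr
          norm_num
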